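/- All graphs are finite. Let $G_1,\dots,G_k$ be simple bipartite plane graphs, where $G_i$ has vertex set $\{1,\dots,|V(G_i)|\}$ and a fixed embedding in the plane, and let $P=G_1\square\cdots\square G_k$ be their Cartesian product. An edge of $P$ is a $G_i$-edge if its ends differ in the $i$-th coordinate. A directed even loop in $P$ is a cyclic sequence $\ell=(w_0,w_1,\dots,w_{2s-1},w_{2s}=w_0)$, $s\ge 1$, with $w_0,\dots,w_{2s-1}$ distinct and consecutive vertices adjacent (for $s=1$ it is a doubled edge, whose two traversals are counted as two edges). The $i$-projection $\tilde\ell_i$ is the multigraph obtained from $\ell$ by contracting all edges that are not $G_i$-edges: its vertices are the $i$-th coordinates of the $w_t$, and each $G_i$-edge $w_tw_{t+1}$ of $\ell$ gives one edge joining the $i$-th coordinates of $w_t$ and $w_{t+1}$. It is drawn in the plane along $G_i$, with parallel edges drawn so close to each other that they enclose no vertex. A cycle decomposition $\mathcal D$ of $\tilde\ell_i$ is a finite family of cycles (two parallel edges being a cycle of size $2$) such that each edge of $\tilde\ell_i$ is in exactly one of them. If the cycles in $\mathcal D$ are directed, the sign of $\mathcal D$ is $$\operatorname{sgn}(\mathcal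 D)=\prod_{d\in\mathcal D}\begin{cases}(-1)^{\chi(d)} & \text{if } d \text{ has odd size and is directed clockwise},\\ (-1)^{\chi(d)+1} & \text{otherwise},\end{cases}$$ where $\chi(d)$ is the number of vertices of $G_i$ enclosed by $d$ (not counting those on $d$). The decomposition is compatible with $\ell$ if every cycle in it runs through its edges in the direction inherited from $\ell$. Finally, let $e_i$ be the number of $G_i$-edges of $\ell$ whose ends, with $j$-th coordinates $v_j$ for $j\neq i$, satisfy $v_{i+1}+\dots+v_k+(k-i)\equiv 1\pmod 2$. The sign of $\ell$ is defined as $$\operatorname{sgn}(\ell)=-\prod_{i=1}^{k-1}(-1)^{e_i}\prod_{j=1}^{k}\operatorname{sgn}(\mathcal D_j),\qquad(*)$$ where $\mathcal D_j$ is a cycle decomposition of $\tilde\ell_j$ compatible with $\ell$, for each $j$. Then the following hold. (a) For every cycle decomposition $\mathcal D$ of a projection $\tilde\ell_i$, $\operatorname{sgn}(\mathcal D)=\prod_{d\in\mathcal D}(-1)^{\chi(d)+1}$; in particular, it does not depend on the directions of the cycles. (b) The sign of a directed even loop $\ell$ in $P$ is well defined: compatible cycle decompositions exist and all of them give the same value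 in $(*)$. Moreover, $(*)$ holds for arbitrary (not necessarily compatible) cycle decompositions $\mathcal D_j$ of $\tilde\ell_j$, $j=1,\dots,k$. (c) Consequently there is no restriction on the choice of the cycle decompositions in the monopole-dimer model on $P$: for vertex weights $x(v)$ and edge weights $a_e$ in a commutative ring and a configuration $C$ consisting of vertex-disjoint directed even loops $\ell_1,\dots,\ell_m$ and the remaining vertices $v_1,\dots,v_r$ as isolated vertices, the weight $$w(C)=\prod_{p=1}^m\Bigl(\operatorname{sgn}(\ell_p)\prod_{e\in E(\ell_p)}a_e\Bigr)\prod_{q=1}^r x(v_q)$$ does not change if each $\operatorname{sgn}(\ell_p)$ is computed by $(*)$ from arbitrary cycle decompositions of the projections of $\ell_p$. -/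

import Mathlib

/-- A finite simple plane graph with natural labels `1, …, n`: the vertex `v : Fin n` carries the
label `v + 1`.  The plane is `ℂ`.  Vertices are distinct points, every edge is drawn as a simple
curve joining its ends, and edges meet each other and the vertices only at common ends.
(The values of `arc` on pairs that are not edges are irrelevant.) -/
structure PlaneGraph (n : ℕ) where
  graph : SimpleGraph (Fin n)
  pos : Fin n → ℂ
  pos_injective : Function.Injective pos
  arc : Sym2 (Fin n) → Set ℂ
  arc_isSimpleCurve : ∀ u v, graph.Adj u v →
    ∃ γ : Path (pos u) (pos v), Function.Injective γ ∧ Set.range γ = arc s(u, v)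
  vertex_on_arc : ∀ e ∈ graph.edgeSet, ∀ v, pos v ∈ arc e → v ∈ e
  arcs_disjoint : ∀ e ∈ graph.edgeSet, ∀ f ∈ graph.edgeSet, e ≠ f →
    arc e ∩ arc f ⊆ Set.range pos

/-- A cycle of size `len` in a loopless multigraph, given by its distinct vertices and distinct
edges in cyclic order (hence with a direction).  Two parallel edges form a cycle of size 2. -/
structure MultiCycle {α β : Type*} (H : Graph α β) where
  len : ℕ
  two_le_len : 2 ≤ len
  vert : ZMod len → α
  edge : ZMod len → β
  vert_injective : Function.Injective vert
  edge_injective : Function.Injective edge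
  isLink : ∀ t, H.IsLink (edge t) (vert t) (vert (t + 1))

/-- A cycle decomposition of a multigraph: a finite family of cycles such that every edge lies in
exactly one of them.  The directions of the cycles are arbitrary. -/
structure CycleDecomposition {α β : Type*} (H : Graph α β) where
  size : ℕ
  cycle : Fin size → MultiCycle H
  covers : ∀ e ∈ H.edgeSet, ∃! j, e ∈ Set.range (cycle j).edge

namespace PlaneGraph

variable {n : ℕ} (G : PlaneGraph n) {β : Type*} {H : Graph (Fin n) β}

/-- The set of points of the plane on the drawing of a cycle (of a multigraph obtained from
`G` by multiplying edges; parallel edges are drawn along the same edge of `G`). -/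
def curve (c : MultiCycle H) : Set ℂ :=
  ⋃ t, G.arc s(c.vert t, c.vert (t + 1))

/-- The point `p` is enclosed by the cycle `c`: it lies in a bounded component of the complement
of the drawing of `c`.  A pair of parallel edges encloses no vertex, by convention. -/
def Encloses (c : MultiCycle H) (p : ℂ) : Prop :=
  3 ≤ c.len ∧ p ∉ G.curve c ∧ Bornology.IsBounded (connectedComponentIn (G.curve c)ᶜ p)

/-- `χ(c)`: the number of vertices of `G` enclosed by the cycle `c`. -/
noncomputable def chi (c : MultiCycle H) : ℕ :=
  {v : Fin n | G.Encloses c (G.pos v)}.ncard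

/-- The cycle `c` is directed clockwise: a parametrisation `γ` of its drawing, which runs through
the edge from `c.vert j` to `c.vert (j + 1)` on `[j, j + 1]`, has winding number `-1` around some
enclosed point `p` (`θ` is a continuous choice of the argument of `γ - p`). -/
def IsClockwise (c : MultiCycle H) : Prop :=
  ∃ (p : ℂ) (γ : ℝ → ℂ) (θ : ℝ → ℝ),
    G.Encloses c p ∧
    ContinuousOn γ (Set.Icc 0 c.len) ∧ Set.InjOn γ (Set.Ico 0 c.len) ∧ γ c.len = γ 0 ∧
    (∀ j : ℕ, j < c.len → γ j = G.pos (c.vert j) ∧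
      γ '' Set.Icc (j : ℝ) (j + 1) = G.arc s(c.vert j, c.vert (j + 1))) ∧
    ContinuousOn θ (Set.Icc 0 c.len) ∧
    (∀ t ∈ Set.Icc (0 : ℝ) c.len, γ t - p = ‖γ t - p‖ * Complex.exp (θ t * Complex.I)) ∧
    θ c.len = θ 0 - 2 * Real.pi

open Classical in
/-- The sign of a (directed) cycle decomposition. -/
noncomputable def sgn (D : CycleDecomposition H) : ℤ :=
  ∏ j, if Odd (D.cycle j).len ∧ G.IsClockwise (D.cycle j)
    then (-1) ^ G.chi (D.cycle j) else (-1) ^ (G.chi (D.cycle j) + 1)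

end PlaneGraph

section CartesianProduct

variable {k : ℕ} {n : Fin k → ℕ} (G : ∀ i, PlaneGraph (n i))

/-- Vertices of the Cartesian product of graphs on `Fin (n i)`, `i : Fin k`. -/
abbrev ProdVertex {k : ℕ} (n : Fin k → ℕ) : Type := (i : Fin k) → Fin (n i)

/-- The Cartesian product `G₁ □ ⋯ □ Gₖ`. -/
def cartesianProduct : SimpleGraph (ProdVertex n) where
  Adj u v := ∃ i, (G i).graph.Adj (u i) (v i) ∧ ∀ j, j ≠ i → u j = v j
  symm := ⟨fun _ _ ⟨i, h, h'⟩ => ⟨i, h.symm, fun j hj => (h' j hj).symm⟩⟩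
  loopless := ⟨fun _ ⟨_, h, _⟩ => h.ne rfl⟩

/-- A directed even loop `(w₀, w₁, …, w₂ₛ = w₀)` in the Cartesian product, `s ≥ 1`.  The case
`s = 1` is a doubled edge. -/
structure EvenLoop where
  s : ℕ
  s_pos : 0 < s
  w : ZMod (2 * s) → ProdVertex n
  w_injective : Function.Injective w
  adj : ∀ t, (cartesianProduct G).Adj (w t) (w (t + 1))

namespace EvenLoop

variable {G} (l : EvenLoop G)

instance : NeZero (2 * l.s) := ⟨by have := l.s_pos; omega⟩

/-- The `t`-th edge of the loop, from `w t` to `w (t + 1)`, is a `Gᵢ`-edge. -/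
def IsEdgeOf (i : Fin k) (t : ZMod (2 * l.s)) : Prop := l.w t i ≠ l.w (t + 1) i

/-- The `i`-projection of the loop, a multigraph supported on `Gᵢ`: all but the `Gᵢ`-edges are
contracted.  Its edges are the (indices of the) `Gᵢ`-edges of the loop. -/
def projection (i : Fin k) : Graph (Fin (n i)) (ZMod (2 * l.s)) where
  vertexSet := Set.range fun t => l.w t i
  IsLink t x y := l.IsEdgeOf i t ∧ s(x, y) = s(l.w t i, l.w (t + 1) i)
  isLink_symm := fun _ _ => ⟨fun _ _ h => ⟨h.1, Sym2.eq_swap.trans h.2⟩⟩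
  eq_or_eq_of_isLink_of_isLink := by
    rintro e x y v w ⟨_, h⟩ ⟨_, h'⟩
    have := h.trans h'.symm
    rw [Sym2.eq_iff] at this
    tauto
  left_mem_of_isLink := by
    rintro e x y ⟨_, h⟩
    rw [Sym2.eq_iff] at h
    rcases h with ⟨h, _⟩ | ⟨h, _⟩
    · exact ⟨e, h.symm⟩
    · exact ⟨e + 1, h.symm⟩

/-- A cycle decomposition of the `i`-projection is compatible with the loop if each of its cycles
runs through each of its edges in the direction inherited from the loop. -/
def IsCompatible {i : Fin k} (D : CycleDecomposition (l.projection i)) : Prop :=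
  ∀ j r, (D.cycle j).vert r = l.w ((D.cycle j).edge r) i ∧
    (D.cycle j).vert (r + 1) = l.w ((D.cycle j).edge r + 1) i

/-- `eᵢ`: the number of `Gᵢ`-edges of the loop which lie in copies of `Gᵢ` in the product with
`vᵢ₊₁ + ⋯ + vₖ + (k - i)` odd.  Here `vⱼ` are labels in `{1, …, n j}`; the index `i : Fin k` stands
for `i + 1` in `{1, …, k}`. -/
noncomputable def e (i : Fin k) : ℕ :=
  {t | l.IsEdgeOf i t ∧
    ((∑ j ∈ Finset.Ioi i, ((l.w t j : ℕ) + 1)) + (k - ((i : ℕ) + 1))) % 2 = 1}.ncard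

/-- The expression `- ∏_{i=1}^{k-1} (-1)^{eᵢ} ∏_{j=1}^k sgn(Dⱼ)`. -/
noncomputable def signOf (D : ∀ i, CycleDecomposition (l.projection i)) : ℤ :=
  -((∏ i ∈ Finset.univ.filter (fun i : Fin k => (i : ℕ) + 1 < k), (-1) ^ l.e i) * ∏ j, (G j).sgn (D j))

/-- `s` is a value of the sign of the loop, as defined by some cycle decompositions of the
projections that are compatible with the loop. -/
def IsSign (s : ℤ) : Prop :=
  ∃ D : ∀ i, CycleDecomposition (l.projection i), (∀ i, l.IsCompatible (D i)) ∧ s = l.signOf D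

open Classical in
/-- The sign `sgn(ℓ)` of the loop, computed from some compatible cycle decompositions. -/
noncomputable def sgn : ℤ := if h : ∃ s, l.IsSign s then h.choose else 0

/-- The product of the weights of the edges of the loop (with multiplicity two for a doubled
edge). -/
def edgeWeight {R : Type*} [CommRing R] (a : Sym2 (ProdVertex n) → R) : R :=
  ∏ t, a s(l.w t, l.w (t + 1))

/-- The weight `w(ℓ) = sgn(ℓ) ∏ a_e` of the loop. -/
noncomputable def weight {R : Type*} [CommRing R] (a : Sym2 (ProdVertex n) → R) : R :=
  (l.sgn : R) * l.edgeWeight a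

end EvenLoop

/-- A monopole-dimer configuration on the Cartesian product: vertex-disjoint directed even loops,
all other vertices being isolated. -/
structure MonopoleDimerConfig where
  size : ℕ
  loop : Fin size → EvenLoop G
  disjoint : ∀ p q, p ≠ q → Disjoint (Set.range (loop p).w) (Set.range (loop q).w)

namespace MonopoleDimerConfig

variable {G} (C : MonopoleDimerConfig G)

open Classical in
/-- The isolated vertices of a configuration. -/
noncomputable def isolated : Finset (ProdVertex n) :=
  {v | ∀ p, v ∉ Set.range (C.loop p).w}

/-- The weight of a configuration for the vertex weights `x` and the edge weights `a`. -/
noncomputable def weight {R : Type*} [CommRing R] (x : ProdVertex n → R)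
    (a : Sym2 (ProdVertex n) → R) : R :=
  (∏ p, (C.loop p).weight a) * ∏ v ∈ C.isolated, x v

end MonopoleDimerConfig

end CartesianProduct

section

open Set Filter Topology

/-- A nonvanishing continuous function on a convex open set has a continuous logarithm. -/
theorem exists_continuousOn_exp_eq {E : Type*} [NormedAddCommGroup E] [NormedSpace ℝ E]
    {U : Set E} (hU : Convex ℝ U) (hUo : IsOpen U) (hne : U.Nonempty) {f : E → ℂ}
    (hf : ContinuousOn f U) (h0 : ∀ x ∈ U, f x ≠ 0) :
    ∃ g : E → ℂ, ContinuousOn g U ∧ ∀ x ∈ U, Complex.exp (g x) = f x := by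
  have hsc : IsSimplyConnected U := by
    have := hU.contractibleSpace hne
    exact SimplyConnectedSpace.ofContractible U
  obtain ⟨g, hg, he⟩ := Complex.exists_continuousOn_eqOn_exp_comp hsc hUo hf
    (by rintro ⟨x, hx, h⟩; exact h0 x hx h)
  exact ⟨g, hg, fun x hx => he hx⟩

theorem exists_continuous_exp_eq {E : Type*} [NormedAddCommGroup E] [NormedSpace ℝ E]
    {f : E → ℂ} (hf : Continuous f) (h0 : ∀ x, f x ≠ 0) :
    ∃ g : E → ℂ, Continuous g ∧ ∀ x, Complex.exp (g x) = f x := by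
  obtain ⟨g, hg, he⟩ := exists_continuousOn_exp_eq (convex_univ (𝕜 := ℝ) (E := E)) isOpen_univ
    univ_nonempty hf.continuousOn fun x _ => h0 x
  exact ⟨g, continuousOn_univ.1 hg, fun x => he x trivial⟩

/-- Two continuous logarithms of the same function on a connected set differ by a constant. -/
theorem sub_eq_sub_of_exp_eq {X : Type*} [TopologicalSpace X] {s : Set X} (hs : IsPreconnected s)
    {f g : X → ℂ} (hf : ContinuousOn f s) (hg : ContinuousOn g s)
    (h : ∀ x ∈ s, Complex.exp (f x) = Complex.exp (g x)) {x y : X} (hx : x ∈ s) (hy : y ∈ s) :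
    f x - f y = g x - g y := by
  have := Complex.isCoveringMap_exp.constOn_of_comp hs (hf.sub hg) (by
    intro a ha b hb
    have (c) (hc : c ∈ s) : Complex.exp (f c - g c) = 1 := by
      rw [Complex.exp_sub, h c hc, div_self (Complex.exp_ne_zero _)]
    simp [this a ha, this b hb]) hx hy
  simp only [Pi.sub_apply] at this
  linear_combination this

/-- A continuous function on a compact space which is constant on the fibres of a continuous map
`γ` to the plane factors through `γ` and a continuous function on the plane. -/
theorem exists_continuous_comp_eq {X : Type*} [TopologicalSpace X] [CompactSpace X] {γ f : X → ℂ}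
    (hγ : Continuous γ) (hf : Continuous f) (h : ∀ x y, γ x = γ y → f x = f y) :
    ∃ g : ℂ → ℂ, Continuous g ∧ ∀ x, g (γ x) = f x := by
  have hK : IsCompact (range γ) := isCompact_range hγ
  have hq : IsQuotientMap (rangeFactorization γ) :=
    IsClosedMap.isQuotientMap (Continuous.isClosedMap (by fun_prop)) (by fun_prop)
      rangeFactorization_surjective
  let f' : range γ → ℂ := fun z => f z.2.choose
  have hf' : f' ∘ rangeFactorization γ = f := by
    ext x
    exact h _ _ (rangeFactorization γ x).2.choose_spec
  have hc : Continuous f' := by rw [hq.continuous_iff, hf']; exact hf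
  obtain ⟨g, hg⟩ := ContinuousMap.exists_restrict_eq hK.isClosed ⟨f', hc⟩
  refine ⟨g, g.continuous, fun x => ?_⟩
  have := congr($hg ⟨γ x, x, rfl⟩)
  rw [← hf']
  exact this

/-- A continuous logarithm of `γ - p` along the curve `γ : [a, b] → ℂ`. -/
structure IsLogAlong (γ : ℝ → ℂ) (a b : ℝ) (p : ℂ) (L : ℝ → ℂ) : Prop where
  continuousOn : ContinuousOn L (Icc a b)
  exp_eq : ∀ s ∈ Icc a b, Complex.exp (L s) = γ s - p

theorem exists_isLogAlong {γ : ℝ → ℂ} (hγ : Continuous γ) {a b : ℝ} (hab : a ≤ b) {p : ℂ}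
    (hp : p ∉ γ '' Icc a b) : ∃ L, IsLogAlong γ a b p L := by
  obtain ⟨L, hL, he⟩ := exists_continuous_exp_eq (E := ℝ)
    (f := fun s => γ (projIcc a b hab s) - p) (by fun_prop)
    (fun s h => hp ⟨projIcc a b hab s, (projIcc a b hab s).2, sub_eq_zero.1 h⟩)
  exact ⟨L, hL.continuousOn, fun s hs => by rw [he, projIcc_of_mem hab hs]⟩

theorem IsLogAlong.sub_eq {γ : ℝ → ℂ} {a b : ℝ} {p : ℂ} {L L' : ℝ → ℂ}
    (h : IsLogAlong γ a b p L) (h' : IsLogAlong γ a b p L') {s t : ℝ} (hs : s ∈ Icc a b)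
    (ht : t ∈ Icc a b) : L s - L t = L' s - L' t :=
  sub_eq_sub_of_exp_eq isPreconnected_Icc h.continuousOn h'.continuousOn
    (fun x hx => by rw [h.exp_eq x hx, h'.exp_eq x hx]) hs ht

theorem IsLogAlong.mono {γ : ℝ → ℂ} {a b c d : ℝ} {p : ℂ} {L : ℝ → ℂ}
    (h : IsLogAlong γ a b p L) (hac : a ≤ c) (hdb : d ≤ b) : IsLogAlong γ c d p L :=
  ⟨h.continuousOn.mono (Icc_subset_Icc hac hdb),
    fun s hs => h.exp_eq s (Icc_subset_Icc hac hdb hs)⟩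

open Classical in
/-- The square root of `(γ b - p) / (γ a - p)` obtained by continuation along the curve `γ`. -/
noncomputable def sqrtRatio (γ : ℝ → ℂ) (a b : ℝ) (p : ℂ) : ℂ :=
  if h : ∃ L, IsLogAlong γ a b p L then Complex.exp ((h.choose b - h.choose a) / 2) else 0

section sqrtRatio

variable {γ : ℝ → ℂ} {a b c : ℝ} {p : ℂ}

theorem IsLogAlong.sqrtRatio_eq (hab : a ≤ b) {L : ℝ → ℂ} (h : IsLogAlong γ a b p L) :
    sqrtRatio γ a b p = Complex.exp ((L b - L a) / 2) := by
  have hex : ∃ L, IsLogAlong γ a b p L := ⟨L, h⟩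
  rw [sqrtRatio, dif_pos hex,
    hex.choose_spec.sub_eq h (right_mem_Icc.2 hab) (left_mem_Icc.2 hab)]

theorem sqrtRatio_sq (hγ : Continuous γ) (hab : a ≤ b) (hp : p ∉ γ '' Icc a b) :
    sqrtRatio γ a b p ^ 2 = (γ b - p) / (γ a - p) := by
  obtain ⟨L, hL⟩ := exists_isLogAlong hγ hab hp
  rw [hL.sqrtRatio_eq hab, ← Complex.exp_nat_mul, ← hL.exp_eq b (right_mem_Icc.2 hab),
    ← hL.exp_eq a (left_mem_Icc.2 hab), ← Complex.exp_sub]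
  congr 1
  push_cast
  ring

theorem sqrtRatio_mul (hγ : Continuous γ) (hab : a ≤ b) (hbc : b ≤ c) (hp : p ∉ γ '' Icc a c) :
    sqrtRatio γ a b p * sqrtRatio γ b c p = sqrtRatio γ a c p := by
  obtain ⟨L, hL⟩ := exists_isLogAlong hγ (hab.trans hbc) hp
  rw [hL.sqrtRatio_eq (hab.trans hbc), (hL.mono le_rfl hbc).sqrtRatio_eq hab,
    (hL.mono hab le_rfl).sqrtRatio_eq hbc, ← Complex.exp_add]
  congr 1
  ring

theorem continuousOn_sqrtRatio (hγ : Continuous γ) (hab : a ≤ b) :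
    ContinuousOn (sqrtRatio γ a b) (γ '' Icc a b)ᶜ := by
  have hK : IsClosed (γ '' Icc a b) := (isCompact_Icc.image hγ).isClosed
  intro p hp
  obtain ⟨r, hr, hball⟩ := Metric.isOpen_iff.1 hK.isOpen_compl p hp
  obtain ⟨F, hF, he⟩ := exists_continuousOn_exp_eq (E := ℝ × ℂ) (U := univ ×ˢ Metric.ball p r)
    (f := fun x => γ (projIcc a b hab x.1) - x.2) (convex_univ.prod (convex_ball p r))
    (isOpen_univ.prod Metric.isOpen_ball) ⟨(0, p), trivial, Metric.mem_ball_self hr⟩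
    (by fun_prop) (fun x hx h => hball hx.2
      ⟨projIcc a b hab x.1, (projIcc a b hab x.1).2, sub_eq_zero.1 h⟩)
  have hLog (q) (hq : q ∈ Metric.ball p r) : IsLogAlong γ a b q fun s => F (s, q) := by
    refine ⟨?_, fun s hs => ?_⟩
    · exact hF.comp (by fun_prop) fun s _ => ⟨trivial, hq⟩
    · rw [he _ ⟨trivial, hq⟩]
      simp only
      rw [projIcc_of_mem hab hs]
  have hcont : ContinuousOn (fun q => Complex.exp ((F (b, q) - F (a, q)) / 2))
      (Metric.ball p r) := by
    have (t : ℝ) : ContinuousOn (fun q => F (t, q)) (Metric.ball p r) :=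
      hF.comp (by fun_prop) fun q hq => ⟨trivial, hq⟩
    exact Complex.continuous_exp.comp_continuousOn (((this b).sub (this a)).div_const 2)
  have hn := Metric.ball_mem_nhds p hr
  refine ContinuousAt.continuousWithinAt ((hcont.continuousAt hn).congr ?_)
  filter_upwards [hn] with q hq
  exact ((hLog q hq).sqrtRatio_eq hab).symm

end sqrtRatio

/-- There is no continuous square root of `(b - p) / (a - p)` on `ℂ \ {a, b}`. -/
theorem not_exists_continuousOn_sqrt {a b : ℂ} (hab : a ≠ b) {u : ℂ → ℂ}
    (hu : ContinuousOn u {a, b}ᶜ) : ¬ ∀ p ∈ ({a, b} : Set ℂ)ᶜ, u p ^ 2 = (b - p) / (a - p) := by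
  intro h
  set r : ℝ := ‖b - a‖ / 2 with hr
  have hr0 : 0 < r := by
    have : 0 < ‖b - a‖ := norm_pos_iff.2 (sub_ne_zero.2 hab.symm)
    positivity
  obtain ⟨g, hg, he⟩ := exists_continuousOn_exp_eq (convex_ball a (2 * r)) Metric.isOpen_ball
    ⟨a, Metric.mem_ball_self (by positivity)⟩ (f := fun p => b - p) (by fun_prop)
    (fun x hx h0 => by
      rw [sub_eq_zero] at h0
      rw [← h0, Metric.mem_ball, dist_eq_norm] at hx
      rw [hr] at hx
      linarith)
  let q : ℝ → ℂ := fun θ => a + r * Complex.exp (θ * Complex.I)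
  have hqn (θ : ℝ) : ‖q θ - a‖ = r := by
    simp [q, Complex.norm_exp_ofReal_mul_I, abs_of_pos hr0]
  have hqb (θ : ℝ) : q θ ∈ Metric.ball a (2 * r) := by
    rw [Metric.mem_ball, dist_eq_norm, hqn]; linarith
  have hqc (θ : ℝ) : q θ ∈ ({a, b} : Set ℂ)ᶜ := by
    rintro (h' | h')
    · have := hqn θ
      rw [h', sub_self, norm_zero] at this
      exact hr0.ne this
    · have := hqn θ
      rw [h'] at this
      rw [hr] at this hr0
      linarith
  have hqcont : Continuous q := by fun_prop
  have huq : Continuous fun θ => u (q θ) :=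
    continuousOn_univ.1 (hu.comp hqcont.continuousOn fun θ _ => hqc θ)
  have hgq : Continuous fun θ => g (q θ) :=
    continuousOn_univ.1 (hg.comp hqcont.continuousOn fun θ _ => hqb θ)
  have hsq (θ : ℝ) : u (q θ) ^ 2 * (-r * Complex.exp (θ * Complex.I)) =
      Complex.exp (g (q θ)) := by
    rw [h _ (hqc θ), he _ (hqb θ)]
    have : a - q θ = -r * Complex.exp (θ * Complex.I) := by simp [q]
    rw [← this, div_mul_cancel₀]
    intro h0
    have h1 := hqn θ
    rw [← neg_sub, h0, neg_zero, norm_zero] at h1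
    exact hr0.ne h1
  have hune (θ : ℝ) : u (q θ) ≠ 0 := by
    intro h0
    have := hsq θ
    rw [h0] at this
    simp at this
    exact Complex.exp_ne_zero _ this.symm
  obtain ⟨k, hk, hke⟩ := exists_continuous_exp_eq huq hune
  obtain ⟨c, hc⟩ : ∃ c : ℂ, Complex.exp c = -r :=
    ⟨Complex.log (-r), Complex.exp_log (by simpa using hr0.ne')⟩
  have key := sub_eq_sub_of_exp_eq (isPreconnected_univ (α := ℝ))
    (f := fun θ : ℝ => 2 * k θ + c + θ * Complex.I) (g := fun θ => g (q θ))
    (Continuous.continuousOn (by fun_prop)) hgq.continuousOn (fun θ _ => by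
      rw [← hsq θ, Complex.exp_add, Complex.exp_add, hc, ← hke]
      rw [← Complex.exp_nat_mul]; push_cast; ring) (x := 2 * Real.pi) (y := 0) trivial trivial
  have hq0 : q (2 * Real.pi) = q 0 := by simp [q]
  simp only [hq0, sub_self] at key
  have hk2 : k (2 * Real.pi) - k 0 = -(Real.pi * Complex.I) := by
    push_cast at key
    linear_combination key / 2
  have : Complex.exp (k (2 * Real.pi) - k 0) = 1 := by
    rw [Complex.exp_sub, hke, hke, hq0, div_self (hune 0)]
  rw [hk2, Complex.exp_neg, Complex.exp_pi_mul_I] at this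
  norm_num at this

/-- A closed simple curve in the plane, parametrised periodically. -/
structure IsJordanCurve (γ : ℝ → ℂ) (m : ℝ) : Prop where
  one_lt : 1 < m
  continuous : Continuous γ
  periodic : Function.Periodic γ m
  injective : ∀ x y, γ x = γ y → ∃ k : ℤ, y = x + k * m

/-- The frontier of a connected component of an open set lies outside of the set. -/
theorem frontier_connectedComponentIn_subset {X : Type*} [TopologicalSpace X]
    [LocallyConnectedSpace X] {U : Set X} (hU : IsOpen U) (x : X) :
    frontier (connectedComponentIn U x) ⊆ Uᶜ := by
  intro y hy hyU
  have hx : IsOpen (connectedComponentIn U x) := hU.connectedComponentIn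
  rw [hx.frontier_eq] at hy
  obtain ⟨z, hzy, hzx⟩ := mem_closure_iff.1 hy.1 _ (hU.connectedComponentIn (x := y))
    (mem_connectedComponentIn hyU)
  exact hy.2 (connectedComponentIn_eq hzx ▸ connectedComponentIn_eq hzy ▸
    mem_connectedComponentIn hyU)

namespace IsJordanCurve

variable {γ : ℝ → ℂ} {m : ℝ} (h : IsJordanCurve γ m) {p q : ℂ}
include h

theorem pos : 0 < m := one_pos.trans h.one_lt

theorem image_Icc : γ '' Icc 0 m = range γ := by
  refine (image_subset_range _ _).antisymm ?_
  rintro _ ⟨x, rfl⟩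
  obtain ⟨y, hy, he⟩ := h.periodic.exists_mem_Ico₀ h.pos x
  exact ⟨y, Ico_subset_Icc_self hy, he.symm⟩

theorem isCompact_range : IsCompact (range γ) :=
  h.image_Icc ▸ isCompact_Icc.image h.continuous

theorem exists_isLogAlong (hp : p ∉ range γ) : ∃ L, IsLogAlong γ 0 m p L :=
  _root_.exists_isLogAlong h.continuous h.pos.le (h.image_Icc ▸ hp)

theorem apply_self : γ m = γ 0 := by simpa using h.periodic 0

theorem eq_or_eq {x y : ℝ} (hx : x ∈ Icc 0 m) (hy : y ∈ Icc 0 m) (he : γ x = γ y) :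
    x = y ∨ x = 0 ∧ y = m ∨ x = m ∧ y = 0 := by
  obtain ⟨k, hk⟩ := h.injective x y he
  have hm := h.pos
  have h1 : k ≤ 1 := by
    by_contra! hk'
    have : (2 : ℝ) ≤ k := by exact_mod_cast hk'
    nlinarith [hx.1, hy.2]
  have h2 : -1 ≤ k := by
    by_contra! hk'
    have : (k : ℝ) ≤ -2 := by exact_mod_cast (by omega : k ≤ -2)
    nlinarith [hx.2, hy.1]
  obtain rfl | rfl | rfl : k = -1 ∨ k = 0 ∨ k = 1 := by omega
  · right; right
    push_cast at hk
    constructor <;> linarith [hx.1, hx.2, hy.1, hy.2]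
  · left
    push_cast at hk
    linarith
  · right; left
    push_cast at hk
    constructor <;> linarith [hx.1, hx.2, hy.1, hy.2]

theorem sqrtRatio_eq_or (hp : p ∉ range γ) :
    sqrtRatio γ 0 m p = 1 ∨ sqrtRatio γ 0 m p = -1 := by
  rw [← sq_eq_one_iff, sqrtRatio_sq h.continuous h.pos.le (h.image_Icc ▸ hp),
    h.apply_self, div_self]
  exact fun h0 => hp ⟨0, sub_eq_zero.1 h0⟩

theorem sqrtRatio_eq_of_mem (hq : q ∈ connectedComponentIn (range γ)ᶜ p) :
    sqrtRatio γ 0 m q = sqrtRatio γ 0 m p := by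
  have hsub := connectedComponentIn_subset (range γ)ᶜ p
  have hp : p ∈ (range γ)ᶜ := connectedComponentIn_nonempty_iff.1 ⟨q, hq⟩
  refine isPreconnected_connectedComponentIn.constant_of_mapsTo (T := {1, -1})
    (Set.Finite.isDiscrete (by simp)) ?_ ?_ hq (mem_connectedComponentIn hp)
  · exact (h.image_Icc ▸ continuousOn_sqrtRatio h.continuous h.pos.le).mono hsub
  · intro z hz
    simpa using h.sqrtRatio_eq_or (hsub hz)

theorem sqrtRatio_eq_one_of_norm_lt (hq : ∀ s, ‖γ s‖ < ‖q‖) : sqrtRatio γ 0 m q = 1 := by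
  have hq0 : q ≠ 0 := norm_pos_iff.1 ((norm_nonneg _).trans_lt (hq 0))
  have hslit (s) : 1 - γ s / q ∈ Complex.slitPlane := by
    left
    have h1 : ‖γ s / q‖ < 1 := by
      rw [norm_div, div_lt_one (norm_pos_iff.2 hq0)]
      exact hq s
    have := (Complex.abs_re_le_norm (γ s / q)).trans_lt h1
    rw [Complex.sub_re, Complex.one_re]
    linarith [(abs_lt.1 this).2]
  have hc := h.continuous
  have hL : IsLogAlong γ 0 m q fun s => Complex.log (1 - γ s / q) + Complex.log (-q) := by
    refine ⟨Continuous.continuousOn ?_, fun s _ => ?_⟩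
    · exact (Continuous.clog (by fun_prop) hslit).add continuous_const
    · rw [Complex.exp_add, Complex.exp_log (Complex.slitPlane_ne_zero (hslit s)),
        Complex.exp_log (neg_ne_zero.2 hq0)]
      field_simp
      ring
  rw [hL.sqrtRatio_eq h.pos.le, h.apply_self]
  simp

theorem exists_sqrtRatio_eq_neg_one : ∃ p, p ∉ range γ ∧ sqrtRatio γ 0 m p = -1 := by
  by_contra! hall
  have hone (p) (hp : p ∉ range γ) : sqrtRatio γ 0 m p = 1 :=
    (h.sqrtRatio_eq_or hp).resolve_right (hall p hp)
  have hab : γ 0 ≠ γ 1 := by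
    intro he
    rcases h.eq_or_eq ⟨le_rfl, h.pos.le⟩ ⟨zero_le_one, h.one_lt.le⟩ he with h' | h' | h' <;>
      linarith [h.one_lt]
  have hinter {p} (h1 : p ∈ γ '' Icc 0 1) (h2 : p ∈ γ '' Icc 1 m) : p = γ 0 ∨ p = γ 1 := by
    obtain ⟨x, hx, rfl⟩ := h1
    obtain ⟨y, hy, he⟩ := h2
    rcases h.eq_or_eq ⟨hx.1, hx.2.trans h.one_lt.le⟩ ⟨zero_le_one.trans hy.1, hy.2⟩ he.symm with
      rfl | ⟨rfl, -⟩ | ⟨rfl, rfl⟩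
    · right; rw [le_antisymm hx.2 hy.1]
    · left; rfl
    · linarith [hy.1]
  have hrange {p} (h1 : p ∉ γ '' Icc 0 1) (h2 : p ∉ γ '' Icc 1 m) : p ∉ range γ := by
    rw [← h.image_Icc, ← Icc_union_Icc_eq_Icc zero_le_one h.one_lt.le, image_union]
    rintro (h' | h')
    exacts [h1 h', h2 h']
  have hmul (p) (h1 : p ∉ γ '' Icc 0 1) (h2 : p ∉ γ '' Icc 1 m) :
      sqrtRatio γ 0 1 p = (sqrtRatio γ 1 m p)⁻¹ := by
    refine eq_inv_of_mul_eq_one_left ?_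
    rw [sqrtRatio_mul h.continuous zero_le_one h.one_lt.le (h.image_Icc ▸ hrange h1 h2),
      hone p (hrange h1 h2)]
  have hsq {p} (h2 : p ∉ γ '' Icc 1 m) :
      sqrtRatio γ 1 m p ^ 2 = (γ 0 - p) / (γ 1 - p) := by
    rw [sqrtRatio_sq h.continuous h.one_lt.le h2, h.apply_self]
  have hne {p} (h2 : p ∉ γ '' Icc 1 m) : sqrtRatio γ 1 m p ≠ 0 := by
    intro h0
    have := hsq h2
    rw [h0, zero_pow two_ne_zero, eq_comm, div_eq_zero_iff, sub_eq_zero, sub_eq_zero] at this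
    rcases this with h' | h'
    · exact h2 ⟨m, ⟨h.one_lt.le, le_rfl⟩, h.apply_self.trans h'⟩
    · exact h2 ⟨1, ⟨le_rfl, h.one_lt.le⟩, h'⟩
  classical
  have ho1 : IsOpen (γ '' Icc 0 1)ᶜ :=
    (isCompact_Icc.image h.continuous).isClosed.isOpen_compl
  have ho2 : IsOpen (γ '' Icc 1 m)ᶜ :=
    (isCompact_Icc.image h.continuous).isClosed.isOpen_compl
  refine not_exists_continuousOn_sqrt hab
    (u := fun p => if p ∉ γ '' Icc 0 1 then sqrtRatio γ 0 1 p else (sqrtRatio γ 1 m p)⁻¹) ?_ ?_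
  · intro p hp
    by_cases h1 : p ∉ γ '' Icc 0 1
    · refine ContinuousAt.continuousWithinAt (ContinuousAt.congr
        ((continuousOn_sqrtRatio h.continuous zero_le_one).continuousAt (ho1.mem_nhds h1)) ?_)
      filter_upwards [ho1.mem_nhds h1] with q hq
      exact (if_pos hq).symm
    · have h2 : p ∉ γ '' Icc 1 m := fun h2 => hp (hinter (not_not.1 h1) h2)
      refine ContinuousAt.continuousWithinAt (ContinuousAt.congr
        (((continuousOn_sqrtRatio h.continuous h.one_lt.le).continuousAt
          (ho2.mem_nhds h2)).inv₀ (hne h2)) ?_)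
      filter_upwards [ho2.mem_nhds h2] with q hq
      split_ifs with h3
      · rfl
      · exact (hmul q h3 hq).symm
  · intro p hp
    split_ifs with h1
    · have h2 : p ∉ γ '' Icc 1 m := fun h2 => hp (hinter h1 h2)
      rw [inv_pow, hsq h2, inv_div]
    · exact sqrtRatio_sq h.continuous zero_le_one h1

/-- A point with odd winding number lies in every bounded component of the complement. -/
theorem mem_of_isBounded (hp : p ∉ range γ)
    (hb : Bornology.IsBounded (connectedComponentIn (range γ)ᶜ p)) (hq : q ∉ range γ)
    (hodd : sqrtRatio γ 0 m q = -1) : q ∈ connectedComponentIn (range γ)ᶜ p := by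
  by_contra hqP
  set P := connectedComponentIn (range γ)ᶜ p with hP
  have hpP : p ∈ P := mem_connectedComponentIn hp
  have hm := h.pos.le
  obtain ⟨L, hL⟩ := h.exists_isLogAlong hp
  obtain ⟨M, hM⟩ := h.exists_isLogAlong hq
  have hint {r} {N : ℝ → ℂ} (hN : IsLogAlong γ 0 m r N) :
      ∃ n : ℤ, N m = N 0 + n * (2 * Real.pi * Complex.I) := by
    rw [← Complex.exp_eq_exp_iff_exists_int, hN.exp_eq m (right_mem_Icc.2 hm),
      hN.exp_eq 0 (left_mem_Icc.2 hm), h.apply_self]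
  obtain ⟨a, ha⟩ := hint hL
  obtain ⟨b, hb'⟩ := hint hM
  have hb0 : b ≠ 0 := by
    rintro rfl
    rw [hM.sqrtRatio_eq hm, hb'] at hodd
    norm_num at hodd
  obtain ⟨g, hg, hge⟩ := exists_continuous_comp_eq (X := Icc (0 : ℝ) m) (γ := fun s => γ s)
    (f := fun s => b * L s - a * M s) (by have := h.continuous; fun_prop)
    (by
      have h1 := continuousOn_iff_continuous_domRestrict.1 hL.continuousOn
      have h2 := continuousOn_iff_continuous_domRestrict.1 hM.continuousOn
      exact (continuous_const.mul h1).sub (continuous_const.mul h2))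
    (by
      rintro ⟨x, hx⟩ ⟨y, hy⟩ hxy
      rcases h.eq_or_eq hx hy hxy with rfl | ⟨rfl, rfl⟩ | ⟨rfl, rfl⟩
      · rfl
      · simp only [ha, hb']; ring
      · simp only [ha, hb']; ring)
  have hK (z) (hz : z ∈ range γ) : Complex.exp (g z) * (z - q) ^ a = (z - p) ^ b := by
    rw [← h.image_Icc] at hz
    obtain ⟨s, hs, rfl⟩ := hz
    rw [hge ⟨s, hs⟩, ← hL.exp_eq s hs, ← hM.exp_eq s hs, Complex.exp_sub,
      ← Complex.exp_int_mul, ← Complex.exp_int_mul]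
    exact div_mul_cancel₀ _ (Complex.exp_ne_zero _)
  have hopen : IsOpen (range γ)ᶜ := h.isCompact_range.isClosed.isOpen_compl
  have hfr : frontier P ⊆ range γ := by
    simpa using frontier_connectedComponentIn_subset hopen p
  have hPo : IsOpen P := hopen.connectedComponentIn
  classical
  have hqcl : q ∉ closure P := by
    intro h'
    rw [closure_eq_self_union_frontier] at h'
    rcases h' with h' | h'
    exacts [hqP h', hq (hfr h')]
  let H : ℂ → ℂ := P.piecewise (fun z => Complex.exp (g z) * (z - q) ^ a) fun z => (z - p) ^ b
  have hHc : Continuous H := by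
    refine continuous_piecewise (fun z hz => hK z (hfr hz)) ?_ ?_
    · refine (Complex.continuous_exp.comp hg).continuousOn.mul
        (ContinuousOn.zpow₀ (by fun_prop) a fun z hz => Or.inl ?_)
      exact sub_ne_zero.2 fun h' => hqcl (h' ▸ hz)
    · refine ContinuousOn.zpow₀ (by fun_prop) b fun z hz => Or.inl ?_
      rw [closure_compl, hPo.interior_eq] at hz
      exact sub_ne_zero.2 fun h' => hz (h' ▸ hpP)
  have hH0 (z) : H z ≠ 0 := by
    by_cases hz : z ∈ P
    · simp only [H, piecewise_eq_of_mem _ _ _ hz]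
      exact mul_ne_zero (Complex.exp_ne_zero _)
        (zpow_ne_zero _ (sub_ne_zero.2 fun h' => hqP (h' ▸ hz)))
    · simp only [H, piecewise_eq_of_notMem _ _ _ hz]
      exact zpow_ne_zero _ (sub_ne_zero.2 fun h' => hz (h' ▸ hpP))
  obtain ⟨k, hk, hke⟩ := exists_continuous_exp_eq hHc hH0
  obtain ⟨R, hR⟩ := hb.subset_ball p
  have hR0 : 0 < R := Metric.nonempty_ball.1 ⟨p, hR hpP⟩
  have hout (θ : ℝ) : p + R * Complex.exp (θ * Complex.I) ∉ P := by
    intro h'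
    have := hR h'
    rw [Metric.mem_ball, dist_eq_norm] at this
    simp [Complex.norm_exp_ofReal_mul_I, abs_of_pos hR0] at this
  have key := sub_eq_sub_of_exp_eq (isPreconnected_univ (α := ℝ))
    (f := fun θ : ℝ => k (p + R * Complex.exp (θ * Complex.I)))
    (g := fun θ : ℝ => b * (Complex.log R + θ * Complex.I))
    (Continuous.continuousOn (by fun_prop)) (Continuous.continuousOn (by fun_prop))
    (fun θ _ => by
      simp only [hke, H, piecewise_eq_of_notMem _ _ _ (hout θ), Complex.exp_int_mul,
        Complex.exp_add]
      rw [Complex.exp_log (by exact_mod_cast hR0.ne')]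
      simp) (x := 2 * Real.pi) (y := 0) trivial trivial
  have : (b : ℂ) * (2 * Real.pi * Complex.I) = 0 := by
    push_cast at key
    simp only [Complex.exp_two_pi_mul_I, zero_mul, Complex.exp_zero, sub_self] at key
    linear_combination -key
  have h2 : (2 * Real.pi * Complex.I : ℂ) ≠ 0 := Complex.two_pi_I_ne_zero
  exact hb0 (by exact_mod_cast (mul_eq_zero.1 this).resolve_right h2)

/-- The bounded component of the complement of a Jordan curve consists of the points around which
the winding number is odd. -/
theorem isBounded_iff (hp : p ∉ range γ) :
    Bornology.IsBounded (connectedComponentIn (range γ)ᶜ p) ↔ sqrtRatio γ 0 m p = -1 := by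
  constructor
  · intro hb
    obtain ⟨q, hq, hodd⟩ := h.exists_sqrtRatio_eq_neg_one
    rw [← hodd, h.sqrtRatio_eq_of_mem (h.mem_of_isBounded hp hb hq hodd)]
  · intro hodd
    obtain ⟨C, hC⟩ := h.isCompact_range.isBounded.exists_norm_le
    refine isBounded_iff_forall_norm_le.2 ⟨C, fun q hq => ?_⟩
    by_contra! hlt
    have := h.sqrtRatio_eq_one_of_norm_lt (q := q) fun s => (hC _ ⟨s, rfl⟩).trans_lt hlt
    rw [h.sqrtRatio_eq_of_mem hq, hodd] at this
    norm_num at this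

end IsJordanCurve

theorem ZMod.sum_eq_sum_range {M : Type*} [AddCommMonoid M] {m : ℕ} [NeZero m] (f : ZMod m → M)
    (a : ZMod m) : ∑ t, f t = ∑ i ∈ Finset.range m, f (a + i) := by
  rw [← Equiv.sum_comp (Equiv.addLeft a) f]
  symm
  refine Finset.sum_bij (fun i _ => (i : ZMod m)) (fun _ _ => Finset.mem_univ _) ?_ ?_
    fun _ _ => rfl
  · intro i hi j hj h
    rw [ZMod.natCast_eq_natCast_iff'] at h
    rwa [Nat.mod_eq_of_lt (Finset.mem_range.1 hi), Nat.mod_eq_of_lt (Finset.mem_range.1 hj)] at h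
  · intro t _
    exact ⟨t.val, Finset.mem_range.2 t.val_lt, by simp⟩

namespace PlaneGraph

variable {n : ℕ} (G : PlaneGraph n)

theorem exists_arc_param {u v : Fin n} (huv : G.graph.Adj u v) :
    ∃ f : ℝ → ℂ, Continuous f ∧ f 0 = G.pos u ∧ f 1 = G.pos v ∧ InjOn f (Icc 0 1) ∧
      f '' Icc 0 1 = G.arc s(u, v) := by
  obtain ⟨γ, hγ, hr⟩ := G.arc_isSimpleCurve u v huv
  refine ⟨γ.extend, γ.continuous_extend, by simp, by simp, ?_, ?_⟩
  · intro x hx y hy h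
    rw [γ.extend_apply hx, γ.extend_apply hy] at h
    exact congr_arg Subtype.val (hγ h)
  · rw [← hr]
    ext z
    constructor
    · rintro ⟨x, hx, rfl⟩
      exact ⟨⟨x, hx⟩, (γ.extend_apply hx).symm⟩
    · rintro ⟨x, rfl⟩
      exact ⟨x, x.2, γ.extend_apply x.2⟩

theorem exists_log_arc {u v : Fin n} (huv : G.graph.Adj u v) {p : ℂ} (hp : p ∉ G.arc s(u, v)) :
    ∃ L : ℂ → ℂ, Continuous L ∧ ∀ z ∈ G.arc s(u, v), Complex.exp (L z) = z - p := by
  obtain ⟨f, hf, -, -, hinj, hr⟩ := G.exists_arc_param huv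
  obtain ⟨M, hM⟩ := exists_isLogAlong hf zero_le_one (hr ▸ hp)
  obtain ⟨L, hL, hLe⟩ := exists_continuous_comp_eq (X := Icc (0 : ℝ) 1) (γ := fun s => f s)
    (f := fun s => M s) (by fun_prop) (continuousOn_iff_continuous_domRestrict.1 hM.continuousOn)
    (fun x y h => by rw [hinj x.2 y.2 h])
  refine ⟨L, hL, fun z hz => ?_⟩
  rw [← hr] at hz
  obtain ⟨s, hs, rfl⟩ := hz
  rw [hLe ⟨s, hs⟩, hM.exp_eq s hs]

open Classical in
/-- A continuous logarithm of `z - p` on the drawing of an edge. -/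
noncomputable def arcLog (e : Sym2 (Fin n)) (p : ℂ) : ℂ → ℂ :=
  if h : ∃ L : ℂ → ℂ, Continuous L ∧ ∀ z ∈ G.arc e, Complex.exp (L z) = z - p then h.choose else 0

theorem arcLog_spec {u v : Fin n} (huv : G.graph.Adj u v) {p : ℂ} (hp : p ∉ G.arc s(u, v)) :
    Continuous (G.arcLog s(u, v) p) ∧
      ∀ z ∈ G.arc s(u, v), Complex.exp (G.arcLog s(u, v) p z) = z - p := by
  have h := G.exists_log_arc huv hp
  rw [arcLog, dif_pos h]
  exact h.choose_spec

/-- The variation of `log (z - p)` along the edge from `u` to `v`. -/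
noncomputable def arcVar (p : ℂ) (u v : Fin n) : ℂ :=
  G.arcLog s(u, v) p (G.pos v) - G.arcLog s(u, v) p (G.pos u)

theorem arcVar_swap (p : ℂ) (u v : Fin n) : G.arcVar p v u = -G.arcVar p u v := by
  rw [arcVar, arcVar, Sym2.eq_swap]
  ring

theorem pos_mem_arc_iff {u v w : Fin n} (huv : G.graph.Adj u v) :
    G.pos w ∈ G.arc s(u, v) ↔ w = u ∨ w = v := by
  constructor
  · intro h
    simpa using G.vertex_on_arc s(u, v) huv w h
  · obtain ⟨f, -, h0, h1, -, hr⟩ := G.exists_arc_param huv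
    rw [← hr]
    rintro (rfl | rfl)
    exacts [⟨0, by simp, h0⟩, ⟨1, by simp, h1⟩]

theorem exp_arcVar {u v : Fin n} (huv : G.graph.Adj u v) {p : ℂ} (hp : p ∉ G.arc s(u, v)) :
    Complex.exp (G.arcVar p u v) = (G.pos v - p) / (G.pos u - p) := by
  have h := (G.arcLog_spec huv hp).2
  rw [arcVar, Complex.exp_sub, h _ ((G.pos_mem_arc_iff huv).2 (Or.inr rfl)),
    h _ ((G.pos_mem_arc_iff huv).2 (Or.inl rfl))]

theorem arcVar_eq_of_isLogAlong {u v : Fin n} (huv : G.graph.Adj u v) {p : ℂ}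
    (hp : p ∉ G.arc s(u, v)) {γ : ℝ → ℂ} (hγ : Continuous γ) {a b : ℝ} (hab : a ≤ b)
    (ha : γ a = G.pos u) (hb : γ b = G.pos v) (hr : γ '' Icc a b = G.arc s(u, v)) {L : ℝ → ℂ}
    (hL : IsLogAlong γ a b p L) : G.arcVar p u v = L b - L a := by
  have h := G.arcLog_spec huv hp
  have hM : IsLogAlong γ a b p fun s => G.arcLog s(u, v) p (γ s) :=
    ⟨(h.1.comp hγ).continuousOn, fun s hs => h.2 _ (hr ▸ mem_image_of_mem γ hs)⟩
  rw [hL.sub_eq hM (right_mem_Icc.2 hab) (left_mem_Icc.2 hab), ha, hb, arcVar]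

/-- The sum over all vertices of `G` off the edge from `u` to `v` of the variations of
`log (z - pos w)` along this edge. -/
noncomputable def totalVar (u v : Fin n) : ℂ :=
  ∑ w with w ≠ u ∧ w ≠ v, G.arcVar (G.pos w) u v

theorem totalVar_swap (u v : Fin n) : G.totalVar v u = -G.totalVar u v := by
  simp only [totalVar, ← Finset.sum_neg_distrib, ← G.arcVar_swap, and_comm]

theorem exp_totalVar {u v : Fin n} (huv : G.graph.Adj u v) :
    Complex.exp (G.totalVar u v) =
      ∏ w with w ≠ u ∧ w ≠ v, (G.pos v - G.pos w) / (G.pos u - G.pos w) := by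
  rw [totalVar, Complex.exp_sum]
  refine Finset.prod_congr rfl fun w hw => G.exp_arcVar huv ?_
  rw [G.pos_mem_arc_iff huv]
  simpa [not_or] using hw

section Cycle

variable {β : Type*} {H : Graph (Fin n) β} (c : MultiCycle H)

/-- The drawing of a cycle of length at least three is a Jordan curve. -/
theorem exists_isJordanCurve (h3 : 3 ≤ c.len)
    (hadj : ∀ t, G.graph.Adj (c.vert t) (c.vert (t + 1))) :
    ∃ γ : ℝ → ℂ, IsJordanCurve γ c.len ∧ ∀ j : ℤ, γ j = G.pos (c.vert j) ∧
      γ '' Icc (j : ℝ) (j + 1) = G.arc s(c.vert j, c.vert (j + 1)) := by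
  choose f hf h0 h1 hinj hr using fun t => G.exists_arc_param (hadj t)
  set γ : ℝ → ℂ := fun x => f (⌊x⌋ : ZMod c.len) (Int.fract x) with hγ
  have hIcc (j : ℤ) (x : ℝ) (hx : x ∈ Icc (j : ℝ) (j + 1)) : γ x = f j (x - j) := by
    rcases hx.2.eq_or_lt with rfl | hlt
    · have hfl : ⌊(j + 1 : ℝ)⌋ = j + 1 := by
        rw [Int.floor_eq_iff]; push_cast; constructor <;> linarith
      simp only [hγ, Int.fract, hfl]
      push_cast
      rw [sub_self, h0, add_sub_cancel_left, h1]
    · have hfl : ⌊x⌋ = j := Int.floor_eq_iff.2 ⟨hx.1, hlt⟩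
      simp only [hγ, Int.fract, hfl]
  have himg (j : ℤ) : γ '' Icc (j : ℝ) (j + 1) = G.arc s(c.vert j, c.vert (j + 1)) := by
    rw [← hr j]
    ext z
    constructor
    · rintro ⟨x, hx, rfl⟩
      exact ⟨x - j, ⟨by linarith [hx.1], by linarith [hx.2]⟩, (hIcc j x hx).symm⟩
    · rintro ⟨x, hx, rfl⟩
      refine ⟨x + j, ⟨by linarith [hx.1], by linarith [hx.2]⟩, ?_⟩
      rw [hIcc j _ ⟨by linarith [hx.1], by linarith [hx.2]⟩, add_sub_cancel_right]
  have hlen : (3 : ℝ) ≤ c.len := by exact_mod_cast h3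
  have hone : (1 : ZMod c.len) ≠ 0 := by
    have : Fact (1 < c.len) := ⟨by omega⟩
    exact one_ne_zero
  refine ⟨γ, ⟨by linarith, ?_, ?_, ?_⟩, fun j => ⟨?_, himg j⟩⟩
  · refine LocallyFinite.continuous (f := fun j : ℤ => Icc (j : ℝ) (j + 1)) ?_ ?_
      (fun j => isClosed_Icc) ?_
    · exact locallyFinite_Icc_of_tendsto tendsto_intCast_atTop_atTop
        (tendsto_atBot_add_const_right _ _ (tendsto_intCast_atBot_iff.2 tendsto_id))
    · exact eq_univ_of_forall fun x => mem_iUnion.2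
        ⟨⌊x⌋, Int.floor_le x, (Int.lt_floor_add_one x).le⟩
    · intro j
      refine ContinuousOn.congr (f := fun x => f j (x - j)) ?_ (hIcc j)
      exact ((hf j).comp (by fun_prop)).continuousOn
  · intro x
    simp only [hγ]
    have : x + (c.len : ℝ) = x + ((c.len : ℤ) : ℝ) := by simp
    rw [this, Int.floor_add_intCast, Int.fract_add_intCast]
    simp
  · intro x y hxy
    simp only [hγ] at hxy
    have hx : Int.fract x ∈ Icc (0 : ℝ) 1 := ⟨Int.fract_nonneg x, (Int.fract_lt_one x).le⟩
    have hy : Int.fract y ∈ Icc (0 : ℝ) 1 := ⟨Int.fract_nonneg y, (Int.fract_lt_one y).le⟩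
    have key : ((⌊x⌋ : ℤ) : ZMod c.len) = ((⌊y⌋ : ℤ) : ZMod c.len) := by
      by_contra hne
      set a : ZMod c.len := ((⌊x⌋ : ℤ) : ZMod c.len) with ha
      set b : ZMod c.len := ((⌊y⌋ : ℤ) : ZMod c.len) with hb
      by_cases he : s(c.vert a, c.vert (a + 1)) = s(c.vert b, c.vert (b + 1))
      · rw [Sym2.eq_iff] at he
        rcases he with ⟨he, -⟩ | ⟨he, he'⟩
        · exact hne (c.vert_injective he)
        · have e1 := c.vert_injective he
          have e2 := c.vert_injective he'
          have h2 : ((2 : ℕ) : ZMod c.len) = 0 := by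
            push_cast
            linear_combination e2 - e1
          rw [ZMod.natCast_eq_zero_iff] at h2
          have := Nat.le_of_dvd two_pos h2
          omega
      · have hm1 : f a (Int.fract x) ∈ G.arc s(c.vert a, c.vert (a + 1)) :=
          hr a ▸ mem_image_of_mem _ hx
        have hm2 : f a (Int.fract x) ∈ G.arc s(c.vert b, c.vert (b + 1)) :=
          hxy ▸ hr b ▸ mem_image_of_mem _ hy
        obtain ⟨v, hv⟩ := G.arcs_disjoint _ (hadj a) _ (hadj b) he ⟨hm1, hm2⟩
        have aux (t : ZMod c.len) (z : ℝ) (hz : Int.fract z ∈ Icc (0 : ℝ) 1)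
            (hv : G.pos v = f t (Int.fract z)) : v = c.vert t := by
          have hm : G.pos v ∈ G.arc s(c.vert t, c.vert (t + 1)) :=
            hv ▸ hr t ▸ mem_image_of_mem _ hz
          rcases (G.pos_mem_arc_iff (hadj t)).1 hm with h | h
          · exact h
          · rw [h, ← h1 t] at hv
            have := hinj t ⟨zero_le_one, le_rfl⟩ hz hv
            linarith [Int.fract_lt_one z]
        exact hne (c.vert_injective ((aux a x hx hv).symm.trans (aux b y hy (hv.trans hxy))))
    rw [key] at hxy
    have hfr := hinj _ hx hy hxy
    rw [ZMod.intCast_eq_intCast_iff_dvd_sub] at key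
    obtain ⟨k, hk⟩ := key
    refine ⟨k, ?_⟩
    have hk' : (⌊y⌋ : ℝ) - ⌊x⌋ = c.len * k := by exact_mod_cast hk
    have e1 := Int.floor_add_fract x
    have e2 := Int.floor_add_fract y
    linarith
  · rw [hIcc j j ⟨le_rfl, by linarith⟩, sub_self, h0]

end Cycle

end PlaneGraph

/-- A continuous logarithm of the secants `γ s - γ t` of a Jordan curve, on `t < s < t + m`. -/
theorem IsJordanCurve.exists_log_secant {γ : ℝ → ℂ} {m : ℝ} (h : IsJordanCurve γ m) :
    ∃ (F : ℝ → ℝ → ℂ) (c : ℂ), Complex.exp c = -1 ∧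
      (∀ s t, t < s → s < t + m → F (t + m) s = F s t + c) ∧
      ∀ t a b, t < a → b < t + m → IsLogAlong γ a b (γ t) fun s => F s t := by
  have hm := h.pos
  have hc := h.continuous
  let U : Set (ℝ × ℝ) := {x | x.2 < x.1 ∧ x.1 < x.2 + m}
  have hUc : Convex ℝ U := by
    rintro ⟨a, b⟩ ⟨h1, h2⟩ ⟨a', b'⟩ ⟨h1', h2'⟩ x y hx hy hxy
    simp only [U, Prod.smul_mk, Prod.mk_add_mk, smul_eq_mul, mem_ofPred_eq] at *
    rcases hx.eq_or_lt with rfl | hx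
    · obtain rfl : y = 1 := by linarith
      constructor <;> linarith
    · obtain rfl : y = 1 - x := by linarith
      constructor <;> nlinarith
  have hUo : IsOpen U :=
    (isOpen_lt continuous_snd continuous_fst).inter
      (isOpen_lt continuous_fst (continuous_snd.add continuous_const))
  have h10 : ((1 : ℝ), (0 : ℝ)) ∈ U := ⟨one_pos, by simpa using h.one_lt⟩
  obtain ⟨F, hF, he⟩ := exists_continuousOn_exp_eq hUc hUo ⟨_, h10⟩
    (f := fun x => γ x.1 - γ x.2) (by fun_prop) (by
      rintro ⟨s, t⟩ ⟨h1, h2⟩ h0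
      simp only at h1 h2
      obtain ⟨k, hk⟩ := h.injective t s (sub_eq_zero.1 h0).symm
      have hk0 : (0 : ℝ) < k := by
        by_contra! hk0
        nlinarith
      have hk1 : (k : ℝ) < 1 := by
        by_contra! hk1
        nlinarith
      have hk0' : 0 < k := by exact_mod_cast hk0
      have hk1' : k < 1 := by exact_mod_cast hk1
      omega)
  have hswap (x : ℝ × ℝ) (hx : x ∈ U) : (x.2 + m, x.1) ∈ U :=
    ⟨hx.2, by simpa using add_lt_add_left hx.1 m⟩
  have hneg (x : ℝ × ℝ) (hx : x ∈ U) :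
      Complex.exp (F (x.2 + m, x.1)) = -Complex.exp (F x) := by
    rw [he _ (hswap x hx), he _ hx, h.periodic]
    ring
  refine ⟨fun s t => F (s, t), F (0 + m, 1) - F (1, 0), ?_, ?_, ?_⟩
  · rw [Complex.exp_sub, hneg _ h10, neg_div, div_self (Complex.exp_ne_zero _)]
  · intro s t h1 h2
    have := sub_eq_sub_of_exp_eq hUc.isPreconnected
      (f := fun x : ℝ × ℝ => F (x.2 + m, x.1)) (g := fun x => F x + Real.pi * Complex.I)
      (hF.comp (by fun_prop) hswap) (hF.add continuousOn_const) (fun x hx => by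
        rw [hneg x hx, Complex.exp_add, Complex.exp_pi_mul_I]
        ring) (x := (s, t)) (y := (1, 0)) ⟨h1, h2⟩ h10
    simp only at this
    linear_combination this
  · intro t a b ha hb
    have hU (s) (hs : s ∈ Icc a b) : (s, t) ∈ U := ⟨ha.trans_le hs.1, hs.2.trans_lt hb⟩
    exact ⟨hF.comp (by fun_prop) hU, fun s hs => he _ (hU s hs)⟩

namespace PlaneGraph

variable {n : ℕ} (G : PlaneGraph n) {β : Type*} {H : Graph (Fin n) β} (c : MultiCycle H)

theorem curve_eq_range (h3 : 3 ≤ c.len) {γ : ℝ → ℂ}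
    (hγ : ∀ j : ℤ, γ '' Icc (j : ℝ) (j + 1) = G.arc s(c.vert j, c.vert (j + 1))) :
    G.curve c = range γ := by
  have : NeZero c.len := ⟨by omega⟩
  ext z
  rw [curve, mem_iUnion]
  constructor
  · rintro ⟨t, ht⟩
    obtain ⟨j, rfl⟩ := ZMod.intCast_surjective t
    rw [← hγ j] at ht
    exact image_subset_range _ _ ht
  · rintro ⟨s, rfl⟩
    refine ⟨(⌊s⌋ : ℤ), ?_⟩
    rw [← hγ]
    exact mem_image_of_mem γ ⟨Int.floor_le s, (Int.lt_floor_add_one s).le⟩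

theorem pos_mem_curve_iff (hadj : ∀ t, G.graph.Adj (c.vert t) (c.vert (t + 1))) {v : Fin n} :
    G.pos v ∈ G.curve c ↔ v ∈ range c.vert := by
  rw [curve, mem_iUnion]
  simp only [G.pos_mem_arc_iff (hadj _)]
  constructor
  · rintro ⟨t, rfl | rfl⟩
    exacts [⟨_, rfl⟩, ⟨_, rfl⟩]
  · rintro ⟨t, rfl⟩
    exact ⟨t, Or.inl rfl⟩

variable {γ : ℝ → ℂ} (hJ : IsJordanCurve γ c.len)
  (hadj : ∀ t, G.graph.Adj (c.vert t) (c.vert (t + 1)))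
  (hγ : ∀ j : ℤ, γ j = G.pos (c.vert j) ∧
    γ '' Icc (j : ℝ) (j + 1) = G.arc s(c.vert j, c.vert (j + 1)))
include hJ hadj hγ

theorem arcVar_cycle_eq {p : ℂ} {j : ℤ} (hp : p ∉ G.arc s(c.vert j, c.vert (j + 1)))
    {L : ℝ → ℂ} (hL : IsLogAlong γ j (j + 1) p L) :
    G.arcVar p (c.vert j) (c.vert (j + 1)) = L (j + 1) - L j := by
  refine G.arcVar_eq_of_isLogAlong (hadj j) hp hJ.continuous (by linarith) (hγ j).1 ?_ (hγ j).2 hL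
  have := (hγ (j + 1)).1
  push_cast at this
  exact this

variable (h3 : 3 ≤ c.len)
include h3

/-- The variation of `log (z - p)` around a cycle, for a point `p` off the cycle. -/
theorem exp_half_sum_arcVar {p : ℂ} (hp : p ∉ G.curve c) :
    Complex.exp ((∑ i ∈ Finset.range c.len, G.arcVar p (c.vert i) (c.vert (i + 1))) / 2) =
      sqrtRatio γ 0 c.len p := by
  have hp' := hp
  rw [G.curve_eq_range c h3 fun j => (hγ j).2] at hp'
  obtain ⟨L, hL⟩ := hJ.exists_isLogAlong hp'
  have (i) (hi : i ∈ Finset.range c.len) :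
      G.arcVar p (c.vert i) (c.vert (i + 1)) = L ((i + 1 : ℕ) : ℝ) - L (i : ℕ) := by
    have hi' : ((i + 1 : ℕ) : ℝ) ≤ c.len := by exact_mod_cast Finset.mem_range.1 hi
    push_cast at hi'
    have := G.arcVar_cycle_eq c hJ hadj hγ (p := p) (j := i) (L := L)
      (fun h => hp (mem_iUnion.2 ⟨_, h⟩))
      (hL.mono (by simp) (by simpa using hi'))
    simpa using this
  rw [Finset.sum_congr rfl this, Finset.sum_range_sub fun i : ℕ => L i,
    hL.sqrtRatio_eq hJ.pos.le]
  simp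

/-- The total of the variations of `log (z - v)` along the edges of a cycle not incident with `v`,
over all vertices `v` of the cycle. -/
theorem exists_sum_arcVar_eq : ∃ a : ℂ, Complex.exp a = -1 ∧
    ∑ j ∈ Finset.range c.len, ∑ i ∈ Finset.range (c.len - 2),
      G.arcVar (G.pos (c.vert j)) (c.vert (j + 1 + i)) (c.vert (j + 1 + i + 1)) =
        (c.len - 2) * a := by
  obtain ⟨F, a, ha, hFa, hF⟩ := hJ.exists_log_secant
  have hlen : (3 : ℝ) ≤ c.len := by exact_mod_cast h3
  refine ⟨a, ha, ?_⟩
  have inner (j : ℕ) : ∑ i ∈ Finset.range (c.len - 2),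
      G.arcVar (G.pos (c.vert j)) (c.vert (j + 1 + i)) (c.vert (j + 1 + i + 1)) =
        (F j ((j : ℝ) - 1) + a) - F ((j + 1 : ℕ) : ℝ) (((j + 1 : ℕ) : ℝ) - 1) := by
    have (i) (hi : i ∈ Finset.range (c.len - 2)) :
        G.arcVar (G.pos (c.vert j)) (c.vert (j + 1 + i)) (c.vert (j + 1 + i + 1)) =
          F (j + 1 + (i + 1 : ℕ)) j - F (j + 1 + i) j := by
      have hi' : i + 3 ≤ c.len := by have := Finset.mem_range.1 hi; omega
      have hi'' : (i : ℝ) + 3 ≤ c.len := by exact_mod_cast hi'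
      have hvj := (hγ j).1
      have hi0 : (0 : ℝ) ≤ i := by positivity
      have := G.arcVar_cycle_eq c hJ hadj hγ (p := G.pos (c.vert j)) (j := j + 1 + i)
        (L := fun s => F s j) ?_ ?_
      · push_cast at this
        rw [this]
        push_cast
        congr 2
        ring
      · rw [G.pos_mem_arc_iff (hadj _)]
        push_cast
        have aux (k : ℕ) (hk : 0 < k) (hk' : k < c.len) : ¬ c.vert j = c.vert (j + k) := by
          intro he
          have h0 := c.vert_injective he
          rw [eq_comm, add_eq_left, ZMod.natCast_eq_zero_iff] at h0
          exact absurd (Nat.le_of_dvd hk h0) (by omega)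
        rintro (he | he)
        · refine aux (1 + i) (by omega) (by omega) (he.trans ?_)
          push_cast
          congr 1
          ring
        · refine aux (1 + i + 1) (by omega) (by omega) (he.trans ?_)
          push_cast
          congr 1
          ring
      · push_cast at hvj ⊢
        rw [← hvj]
        refine hF _ _ _ (by linarith) ?_
        linarith
    rw [Finset.sum_congr rfl this, Finset.sum_range_sub fun i : ℕ => F (j + 1 + i) j,
      ← hFa j (j - 1) (by linarith) (by linarith), Nat.cast_sub (by omega)]
    push_cast
    congr 2 <;> ring
  rw [Finset.sum_congr rfl fun j _ => inner j]
  have hend : F c.len (c.len - 1) = F 0 (0 - 1) + 2 * a := by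
    have h1 := hFa (c.len - 1) 0 (by linarith) (by linarith)
    have h2 := hFa 0 (-1) (by linarith) (by linarith)
    rw [zero_add] at h1
    rw [neg_add_eq_sub] at h2
    rw [h1, h2, zero_sub]
    ring
  have hsum := Finset.sum_range_sub' (fun j : ℕ => F j ((j : ℝ) - 1)) c.len
  have : ∀ j : ℕ, (F j ((j : ℝ) - 1) + a) - F ((j + 1 : ℕ) : ℝ) (((j + 1 : ℕ) : ℝ) - 1) =
      (F j ((j : ℝ) - 1) - F ((j + 1 : ℕ) : ℝ) (((j + 1 : ℕ) : ℝ) - 1)) + a := fun j => by ring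
  simp only [this, Finset.sum_add_distrib, hsum]
  rw [hend]
  simp
  ring

end PlaneGraph

/-- Splitting a sum over the vertices and edges of a cycle, the vertex not being on the edge. -/
theorem sum_sum_cycle_eq {V M : Type*} [Fintype V] [DecidableEq V] [AddCommMonoid M] {m : ℕ}
    (h3 : 3 ≤ m) {v : ZMod m → V} [DecidablePred (· ∈ range v)] (hv : Function.Injective v)
    (f : V → ZMod m → M) :
    ∑ i ∈ Finset.range m, ∑ w with w ≠ v i ∧ w ≠ v (i + 1), f w i =
      (∑ w with w ∉ range v, ∑ i ∈ Finset.range m, f w i) +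
        ∑ j ∈ Finset.range m, ∑ i ∈ Finset.range (m - 2), f (v j) (j + 1 + i) := by
  have : NeZero m := ⟨by omega⟩
  have e0 (g : ZMod m → M) : ∑ i ∈ Finset.range m, g i = ∑ t, g t := by
    rw [ZMod.sum_eq_sum_range g 0]
    simp
  have hne (j : ZMod m) (k : ℕ) (hk : 0 < k) (hk' : k < m) : j ≠ j + k := by
    intro he
    rw [eq_comm, add_eq_left, ZMod.natCast_eq_zero_iff] at he
    exact absurd (Nat.le_of_dvd hk he) (by omega)
  rw [e0 fun t => ∑ w with w ≠ v t ∧ w ≠ v (t + 1), f w t,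
    e0 fun t => ∑ i ∈ Finset.range (m - 2), f (v t) (t + 1 + i)]
  simp only [e0 (f _)]
  have key (j : ZMod m) : ∑ i ∈ Finset.range (m - 2), f (v j) (j + 1 + i) =
      ∑ t, if v j ≠ v t ∧ v j ≠ v (t + 1) then f (v j) t else 0 := by
    rw [ZMod.sum_eq_sum_range _ (j + 1)]
    obtain ⟨q, rfl⟩ : ∃ q, m = q + 2 := ⟨m - 2, by omega⟩
    rw [Finset.sum_range_succ, Finset.sum_range_succ, Nat.add_sub_cancel]
    have hz : ((q : ZMod (q + 2)) + 2) = 0 := by exact_mod_cast ZMod.natCast_self (q + 2)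
    rw [if_neg, if_neg, add_zero, add_zero]
    · refine Finset.sum_congr rfl fun i hi => (if_pos ?_).symm
      have hi := Finset.mem_range.1 hi
      refine ⟨hv.ne ?_, hv.ne ?_⟩
      · have := hne j (1 + i) (by omega) (by omega)
        push_cast at this
        rwa [← add_assoc] at this
      · have := hne j (1 + i + 1) (by omega) (by omega)
        push_cast at this
        rwa [← add_assoc, ← add_assoc] at this
    · rintro ⟨h, -⟩
      refine h (congr_arg v ?_)
      push_cast
      linear_combination -hz
    · rintro ⟨-, h⟩
      refine h (congr_arg v ?_)
      linear_combination -hz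
  simp only [key, Finset.sum_filter]
  rw [Finset.sum_comm, ← Finset.sum_filter, ← Finset.sum_filter_add_sum_filter_not Finset.univ
    fun w => w ∉ range v]
  congr 1
  · refine Finset.sum_congr rfl fun w hw => Finset.sum_congr rfl fun t _ => if_pos ?_
    have hw := (Finset.mem_filter.1 hw).2
    exact ⟨fun h => hw ⟨_, h.symm⟩, fun h => hw ⟨_, h.symm⟩⟩
  · rw [← Finset.sum_image (s := Finset.univ) (g := v)
      (f := fun w => ∑ t, if w ≠ v t ∧ w ≠ v (t + 1) then f w t else 0) hv.injOn]
    refine Finset.sum_congr ?_ fun _ _ => rfl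
    ext w
    simp

namespace PlaneGraph

variable {n : ℕ} (G : PlaneGraph n)

theorem exp_half_sum_totalVar {β : Type*} {H : Graph (Fin n) β} (c : MultiCycle H)
    (h3 : 3 ≤ c.len) (heven : Even c.len) (hadj : ∀ t, G.graph.Adj (c.vert t) (c.vert (t + 1))) :
    Complex.exp ((∑ i ∈ Finset.range c.len, G.totalVar (c.vert i) (c.vert (i + 1))) / 2) =
      (-1) ^ G.chi c * (-1) ^ (c.len / 2 - 1) := by
  classical
  obtain ⟨γ, hJ, hγ⟩ := G.exists_isJordanCurve c h3 hadj
  obtain ⟨a, ha, hsum⟩ := G.exists_sum_arcVar_eq c hJ hadj hγ h3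
  have hcurve := G.curve_eq_range c h3 fun j => (hγ j).2
  have hsplit := sum_sum_cycle_eq h3 c.vert_injective
    fun w t => G.arcVar (G.pos w) (c.vert t) (c.vert (t + 1))
  simp only [totalVar]
  rw [hsplit, hsum, add_div, Complex.exp_add, Finset.sum_div, Complex.exp_sum]
  congr 1
  · have hw (w) (hw : w ∈ Finset.univ.filter fun w => w ∉ range c.vert) : Complex.exp
        ((∑ i ∈ Finset.range c.len, G.arcVar (G.pos w) (c.vert i) (c.vert (i + 1))) / 2) =
          if G.Encloses c (G.pos w) then -1 else 1 := by
      have hw' : G.pos w ∉ G.curve c := fun h =>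
        (Finset.mem_filter.1 hw).2 ((G.pos_mem_curve_iff c hadj).1 h)
      rw [G.exp_half_sum_arcVar c hJ hadj hγ h3 hw']
      have hiff : G.Encloses c (G.pos w) ↔ sqrtRatio γ 0 c.len (G.pos w) = -1 := by
        rw [Encloses, ← hJ.isBounded_iff (hcurve ▸ hw'), hcurve]
        exact ⟨fun h => h.2.2, fun h => ⟨h3, hcurve ▸ hw', h⟩⟩
      split_ifs with h
      · exact hiff.1 h
      · exact (hJ.sqrtRatio_eq_or (hcurve ▸ hw')).resolve_right fun h' => h (hiff.2 h')
    rw [Finset.prod_congr rfl hw, Finset.prod_ite, Finset.prod_const, Finset.prod_const_one,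
      mul_one, chi, Set.ncard_eq_toFinset_card']
    congr 2
    ext w
    simp only [Finset.mem_filter, Finset.mem_univ, true_and, mem_toFinset, mem_ofPred_eq]
    refine ⟨fun h => h.2, fun h => ⟨fun h' => h.2.1 ?_, h⟩⟩
    exact (G.pos_mem_curve_iff c hadj).2 h'
  · obtain ⟨q, hq⟩ := heven
    have hq' : c.len / 2 - 1 = q - 1 := by omega
    rw [hq', ← ha, ← Complex.exp_nat_mul, hq, Nat.cast_sub (by omega)]
    congr 1
    push_cast
    ring

/-- The cycles of a bipartite graph have even length. -/
theorem even_len_of_alternating {β : Type*} {H : Graph (Fin n) β} (c : MultiCycle H)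
    {ε : Fin n → ℤ} (hε : ∀ v, ε v ≠ 0) (hadj : ∀ t, ε (c.vert (t + 1)) = -ε (c.vert t)) :
    Even c.len := by
  have h (i : ℕ) : ε (c.vert i) = (-1) ^ i * ε (c.vert 0) := by
    induction i with
    | zero => simp
    | succ i ih => push_cast; rw [hadj, ih, pow_succ]; ring
  have := h c.len
  rw [ZMod.natCast_self] at this
  by_contra hodd
  rw [Nat.not_even_iff_odd] at hodd
  rw [hodd.neg_one_pow] at this
  exact hε (c.vert 0) (by linarith)

theorem exists_alternating (hG : G.graph.IsBipartite) :
    ∃ ε : Fin n → ℤ, (∀ v, ε v ≠ 0) ∧ ∀ u v, G.graph.Adj u v → ε v = -ε u := by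
  obtain ⟨C⟩ := hG
  refine ⟨fun v => if C v = 0 then 1 else -1, fun v => by dsimp only; split_ifs <;> simp,
    fun u v huv => ?_⟩
  have := C.valid huv
  revert this
  dsimp only
  generalize C u = a
  generalize C v = b
  revert a b
  decide

/-- There is a sign `±1` for every edge of a bipartite plane graph such that the sign of a cycle
is the product of the signs of its edges and of `-1` for every second edge. -/
theorem exists_edgeSign (hG : G.graph.IsBipartite) : ∃ σ : Sym2 (Fin n) → ℤ,
    ∀ {β : Type*} {H : Graph (Fin n) β} (c : MultiCycle H),
      (∀ t, G.graph.Adj (c.vert t) (c.vert (t + 1))) →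
        (-1) ^ (G.chi c + 1) =
          (-1) ^ (c.len / 2) * ∏ i ∈ Finset.range c.len, σ s(c.vert i, c.vert (i + 1)) := by
  classical
  obtain ⟨ε, hε0, hε⟩ := G.exists_alternating hG
  let U : Fin n → ℂ := fun x => ε x * ∏ w with w ≠ x, (G.pos x - G.pos w)
  have hU0 (x) : U x ≠ 0 := by
    refine mul_ne_zero (by exact_mod_cast hε0 x) (Finset.prod_ne_zero_iff.2 fun w hw => ?_)
    exact sub_ne_zero.2 fun h => (Finset.mem_filter.1 hw).2 (G.pos_injective h).symm
  have hUsplit {x y} (hxy : x ≠ y) : U x =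
      ε x * ((G.pos x - G.pos y) * ∏ w with w ≠ x ∧ w ≠ y, (G.pos x - G.pos w)) := by
    simp only [U]
    rw [← Finset.mul_prod_erase (Finset.univ.filter fun w => w ≠ x) _ (a := y)
      (by simpa using hxy.symm)]
    congr 3
    ext w
    simp [and_comm]
  choose r hr using fun x => IsAlgClosed.exists_pow_nat_eq (U x) two_pos
  have hr0 (x) : r x ≠ 0 := fun h => hU0 x (by rw [← hr, h]; simp)
  let S : Fin n → Fin n → ℂ := fun x y => Complex.exp (G.totalVar x y / 2) * (r x / r y)
  have hS1 {x y} (hxy : G.graph.Adj x y) : S x y ^ 2 = 1 := by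
    have hcond : ∏ w with w ≠ y ∧ w ≠ x, (G.pos y - G.pos w) =
        ∏ w with w ≠ x ∧ w ≠ y, (G.pos y - G.pos w) := by simp only [and_comm]
    have h1 := hUsplit hxy.ne
    have h2 := hUsplit hxy.ne.symm
    rw [hcond] at h2
    have h1' := h1 ▸ hU0 x
    have h2' := h2 ▸ hU0 y
    simp only [S]
    rw [mul_pow, div_pow, hr, hr, ← Complex.exp_nat_mul, h1, h2]
    push_cast
    rw [mul_div_cancel₀ _ (two_ne_zero), G.exp_totalVar hxy, Finset.prod_div_distrib, hε x y hxy]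
    simp only [ne_eq, mul_eq_zero, not_or, hε x y hxy] at h1' h2'
    obtain ⟨hx, hd, hp⟩ := h1'
    obtain ⟨-, hd', hp'⟩ := h2'
    push_cast
    field_simp
    ring
  have hSs {x y} (hxy : G.graph.Adj x y) : S y x = S x y := by
    have h1 : S x y * S y x = 1 := by
      have e1 := hr0 x
      have e2 := hr0 y
      simp only [S, G.totalVar_swap x y]
      rw [neg_div, Complex.exp_neg]
      have := Complex.exp_ne_zero (G.totalVar x y / 2)
      field_simp
    have h2 := hS1 hxy
    have h0 : S x y ≠ 0 := left_ne_zero_of_mul_eq_one h1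
    refine mul_left_cancel₀ h0 ?_
    rw [h1, ← h2, sq]
  let σ : Sym2 (Fin n) → ℤ := fun e =>
    if ∃ x y, G.graph.Adj x y ∧ e = s(x, y) ∧ S x y = 1 then 1 else -1
  have hσ {x y} (hxy : G.graph.Adj x y) : (σ s(x, y) : ℂ) = S x y := by
    simp only [σ]
    split_ifs with h
    · obtain ⟨x', y', h', he, h1⟩ := h
      rw [Sym2.eq_iff] at he
      rcases he with ⟨rfl, rfl⟩ | ⟨rfl, rfl⟩
      · simp [h1]
      · simp [hSs h', h1]
    · push_cast
      refine ((sq_eq_one_iff.1 (hS1 hxy)).resolve_left fun h1 => h ⟨x, y, hxy, rfl, h1⟩).symm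
  refine ⟨σ, fun {β H} c hadj => ?_⟩
  have heven : Even c.len := even_len_of_alternating c hε0 fun t => hε _ _ (hadj t)
  have h2 := c.two_le_len
  have hprod : ((∏ i ∈ Finset.range c.len, σ s(c.vert i, c.vert (i + 1)) : ℤ) : ℂ) =
      Complex.exp ((∑ i ∈ Finset.range c.len, G.totalVar (c.vert i) (c.vert (i + 1))) / 2) := by
    rw [Int.cast_prod, Finset.prod_congr rfl fun (i : ℕ) _ => hσ (hadj i), Finset.prod_mul_distrib,
      ← Complex.exp_sum, Finset.sum_div]
    have : ∏ i ∈ Finset.range c.len, (r (c.vert i) / r (c.vert (i + 1))) = 1 := by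
      have (N : ℕ) : ∏ i ∈ Finset.range N, (r (c.vert i) / r (c.vert (i + 1))) =
          r (c.vert 0) / r (c.vert N) := by
        induction N with
        | zero => simp [hr0]
        | succ N ih =>
          rw [Finset.prod_range_succ, ih, div_mul_div_cancel₀ (hr0 _)]
          push_cast
          rfl
      rw [this, ZMod.natCast_self, div_self (hr0 _)]
    rw [this, mul_one]
  have hcast : ((-1 : ℂ)) ^ (G.chi c + 1) = (-1) ^ (c.len / 2) *
      ((∏ i ∈ Finset.range c.len, σ s(c.vert i, c.vert (i + 1)) : ℤ) : ℂ) := by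
    rw [hprod]
    by_cases h3 : 3 ≤ c.len
    · rw [G.exp_half_sum_totalVar c h3 heven hadj]
      obtain ⟨q, hq⟩ : ∃ q, c.len / 2 = q + 1 := ⟨c.len / 2 - 1, by omega⟩
      rw [hq, Nat.add_sub_cancel, pow_succ, pow_succ, mul_comm _ ((-1 : ℂ) ^ q)]
      have : ((-1 : ℂ) ^ q) * (-1) ^ q = 1 := by rw [← mul_pow]; simp
      linear_combination ((-1) ^ G.chi c) * this
    · have hlen : c.len = 2 := by omega
      have hchi : G.chi c = 0 := by
        rw [chi, Set.ncard_eq_zero]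
        exact eq_empty_of_forall_notMem fun v hv => h3 hv.1
      have hz : ((0 : ℕ) + 1 + 1 : ZMod c.len) = 0 := by
        have := ZMod.natCast_self c.len
        rw [hlen] at this ⊢
        push_cast at this ⊢
        linear_combination this
      have hrange : Finset.range c.len = {0, 1} := by rw [hlen]; rfl
      rw [hchi, show c.len / 2 = 1 by omega, hrange, Finset.sum_pair zero_ne_one]
      push_cast at hz ⊢
      rw [zero_add] at hz
      rw [zero_add, hz, G.totalVar_swap (c.vert 0)]
      simp
  exact_mod_cast hcast

end PlaneGraph

@[to_additive]
theorem CycleDecomposition.prod_prod_edge {α β M : Type*} [CommMonoid M] {H : Graph α β}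
    (D : CycleDecomposition H) {E : Finset β} (hE : ∀ e, e ∈ E ↔ e ∈ H.edgeSet) (f : β → M) :
    ∏ j, ∏ i ∈ Finset.range (D.cycle j).len, f ((D.cycle j).edge i) = ∏ e ∈ E, f e := by
  have hmem (j t) : (D.cycle j).edge t ∈ H.edgeSet := ((D.cycle j).isLink t).edge_mem
  rw [Finset.prod_sigma']
  refine Finset.prod_bij (fun x _ => (D.cycle x.1).edge (x.2 : ℕ)) ?_ ?_ ?_ fun _ _ => rfl
  · intro x _
    exact (hE _).2 (hmem _ _)
  · rintro ⟨j, a⟩ ha ⟨j', b⟩ hb h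
    simp only [Finset.mem_sigma, Finset.mem_univ, Finset.mem_range, true_and] at ha hb h
    obtain rfl : j = j' := (D.covers _ (hmem j a)).unique ⟨_, rfl⟩ ⟨_, h.symm⟩
    have := (D.cycle j).edge_injective h
    rw [ZMod.natCast_eq_natCast_iff', Nat.mod_eq_of_lt ha, Nat.mod_eq_of_lt hb] at this
    rw [this]
  · intro e he
    obtain ⟨j, ⟨t, ht⟩, -⟩ := D.covers e ((hE e).1 he)
    have : NeZero (D.cycle j).len := ⟨by have := (D.cycle j).two_le_len; omega⟩
    exact ⟨⟨j, t.val⟩, by simpa using t.val_lt, by simpa using ht⟩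

/-- A nonempty set of directed edges such that every head is a tail contains a directed cycle. -/
theorem MultiCycle.exists_directed {α β : Type*} {H : Graph α β} {tail head : β → α}
    {S : Finset β} (hS : S.Nonempty) (hlink : ∀ e ∈ S, H.IsLink e (tail e) (head e))
    (hne : ∀ e ∈ S, tail e ≠ head e) (hnext : ∀ e ∈ S, ∃ e' ∈ S, tail e' = head e) :
    ∃ c : MultiCycle H, ∀ r, c.edge r ∈ S ∧ c.vert r = tail (c.edge r) ∧
      c.vert (r + 1) = head (c.edge r) := by
  have hout (v : tail '' (S : Set β)) : ∃ e ∈ S, tail e = v := v.2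
  choose out hmem htail using hout
  have hg (v : tail '' (S : Set β)) : head (out v) ∈ tail '' (S : Set β) := hnext _ (hmem v)
  let g : tail '' (S : Set β) → tail '' (S : Set β) := fun v => ⟨_, hg v⟩
  have : Finite (tail '' (S : Set β)) := (S.finite_toSet.image tail).to_subtype
  obtain ⟨e₀, he₀⟩ := hS
  obtain ⟨y, hy⟩ : ∃ y, y ∈ Function.periodicPts g := by
    let x : tail '' (S : Set β) := ⟨_, e₀, he₀, rfl⟩
    obtain ⟨a, b, hab, h⟩ := Finite.exists_ne_map_eq_of_infinite fun k : ℕ => g^[k] x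
    wlog hlt : a < b generalizing a b
    · exact this b a hab.symm h.symm (by omega)
    refine ⟨g^[a] x, b - a, by omega, ?_⟩
    rw [Function.IsPeriodicPt, Function.IsFixedPt, ← Function.iterate_add_apply]
    have h : g^[a] x = g^[b] x := h
    rw [h]
    congr 2
    omega
  set m := Function.minimalPeriod g y with hm
  have hm0 : 0 < m := Function.minimalPeriod_pos_of_mem_periodicPts hy
  have hm1 : m ≠ 1 := by
    intro h1
    rw [hm, Function.minimalPeriod_eq_one_iff_isFixedPt] at h1
    refine hne _ (hmem y) ((htail y).trans ?_)
    exact (congr_arg Subtype.val h1).symm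
  have : NeZero m := ⟨hm0.ne'⟩
  have : Fact (1 < m) := ⟨by omega⟩
  have hsucc (t : ZMod m) : g^[(t + 1).val] y = g (g^[t.val] y) := by
    have h : g^[(t.val + 1) % m] y = g^[t.val + 1] y := Function.iterate_mod_minimalPeriod_eq
    rw [ZMod.val_add, ZMod.val_one, h, Function.iterate_succ_apply']
  have hinj : Function.Injective fun t : ZMod m => (g^[t.val] y : α) := by
    intro s t h
    exact ZMod.val_injective m (Function.iterate_injOn_Iio_minimalPeriod s.val_lt t.val_lt
      (Subtype.ext h))
  refine ⟨⟨m, by omega, fun t => g^[t.val] y, fun t => out (g^[t.val] y), hinj, ?_, ?_⟩, ?_⟩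
  · intro s t h
    refine hinj ?_
    simp only at h ⊢
    rw [← htail, h, htail]
  · intro t
    have := hlink _ (hmem (g^[t.val] y))
    rw [htail] at this
    rwa [hsucc]
  · intro t
    refine ⟨hmem _, (htail _).symm, ?_⟩
    simp only
    rw [hsucc]

/-- A balanced directed multigraph decomposes into directed cycles. -/
theorem MultiCycle.exists_decomposition {α β : Type*} [DecidableEq α] [DecidableEq β]
    {H : Graph α β} {tail head : β → α} (S : Finset β)
    (hlink : ∀ e ∈ S, H.IsLink e (tail e) (head e)) (hne : ∀ e ∈ S, tail e ≠ head e)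
    (hbal : ∀ v, (S.filter fun e => tail e = v).card = (S.filter fun e => head e = v).card) :
    ∃ (N : ℕ) (c : Fin N → MultiCycle H),
      (∀ j r, (c j).edge r ∈ S ∧ (c j).vert r = tail ((c j).edge r) ∧
        (c j).vert (r + 1) = head ((c j).edge r)) ∧
      ∀ e ∈ S, ∃! j, e ∈ range (c j).edge := by
  induction S using Finset.strongInduction with
  | H S ih =>
    rcases S.eq_empty_or_nonempty with rfl | hS
    · exact ⟨0, Fin.elim0, fun j => j.elim0, by simp⟩
    obtain ⟨c, hc⟩ := exists_directed hS hlink hne fun e he => by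
      have : (S.filter fun e' => tail e' = head e).Nonempty := by
        rw [← Finset.card_pos, hbal, Finset.card_pos]
        exact ⟨e, Finset.mem_filter.2 ⟨he, rfl⟩⟩
      obtain ⟨e', he'⟩ := this
      exact ⟨e', (Finset.mem_filter.1 he').1, (Finset.mem_filter.1 he').2⟩
    have : NeZero c.len := ⟨by have := c.two_le_len; omega⟩
    set C : Finset β := Finset.univ.image c.edge with hC
    have hCS : C ⊆ S := by
      intro e he
      obtain ⟨r, -, rfl⟩ := Finset.mem_image.1 he
      exact (hc r).1
    have hmemC (r) : c.edge r ∈ C := Finset.mem_image_of_mem _ (Finset.mem_univ r)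
    have hCbal (v) : (C.filter fun e => tail e = v).card = (C.filter fun e => head e = v).card := by
      rw [hC, Finset.filter_image, Finset.filter_image,
        Finset.card_image_of_injective _ c.edge_injective,
        Finset.card_image_of_injective _ c.edge_injective]
      simp only [← (hc _).2.1, ← (hc _).2.2]
      exact (Finset.card_bij (fun r _ => r + 1) (by simp) (fun _ _ _ _ h => add_right_cancel h)
        fun r hr => ⟨r - 1, by simpa using hr, by simp⟩).symm
    have hsd (p : β → Prop) [DecidablePred p] :
        ((S \ C).filter p).card = (S.filter p).card - (C.filter p).card := by
      rw [← Finset.card_sdiff_of_subset (Finset.filter_subset_filter p hCS)]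
      congr 1
      ext e
      simp only [Finset.mem_filter, Finset.mem_sdiff]
      tauto
    obtain ⟨N, d, hd, hcov⟩ := ih (S \ C)
      (Finset.sdiff_ssubset hCS ⟨_, hmemC 0⟩)
      (fun e he => hlink e (Finset.sdiff_subset he)) (fun e he => hne e (Finset.sdiff_subset he))
      (fun v => by rw [hsd, hsd, hbal, hCbal])
    refine ⟨N + 1, Fin.cons c d, fun j => ?_, fun e he => ?_⟩
    · refine Fin.cases ?_ (fun j => ?_) j
      · exact hc
      · exact fun r => ⟨Finset.sdiff_subset (hd j r).1, (hd j r).2⟩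
    · by_cases heC : e ∈ C
      · obtain ⟨r, -, hr⟩ := Finset.mem_image.1 heC
        refine ⟨0, ⟨r, hr⟩, fun j => ?_⟩
        refine Fin.cases (fun _ => rfl) (fun j => ?_) j
        rintro ⟨r', hr'⟩
        have := (hd j r').1
        have hr' : (d j).edge r' = e := hr'
        rw [hr'] at this
        exact absurd heC (Finset.mem_sdiff.1 this).2
      · obtain ⟨j, hj, huniq⟩ := hcov e (Finset.mem_sdiff.2 ⟨he, heC⟩)
        refine ⟨j.succ, hj, fun j' => ?_⟩
        refine Fin.cases ?_ (fun j' => ?_) j'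
        · rintro ⟨r, hr⟩
          exact absurd (hr ▸ hmemC r) heC
        · intro h
          rw [huniq j' h]

namespace EvenLoop

variable {k : ℕ} {n : Fin k → ℕ} {G : ∀ i, PlaneGraph (n i)} (l : EvenLoop G)

theorem adj_of_isEdgeOf {i : Fin k} {t : ZMod (2 * l.s)} (h : l.IsEdgeOf i t) :
    (G i).graph.Adj (l.w t i) (l.w (t + 1) i) := by
  obtain ⟨j, hj, hne⟩ := l.adj t
  by_cases hij : i = j
  · subst hij
    exact hj
  · exact absurd (hne i hij) h

theorem adj_of_isLink {i : Fin k} {t : ZMod (2 * l.s)} {x y : Fin (n i)}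
    (h : (l.projection i).IsLink t x y) : (G i).graph.Adj x y := by
  rw [← SimpleGraph.mem_edgeSet, h.2]
  exact l.adj_of_isEdgeOf h.1

theorem mem_edgeSet_projection {i : Fin k} {t : ZMod (2 * l.s)} :
    t ∈ (l.projection i).edgeSet ↔ l.IsEdgeOf i t := by
  rw [Graph.edge_mem_iff_exists_isLink]
  exact ⟨fun ⟨_, _, h⟩ => h.1, fun h => ⟨_, _, h, rfl⟩⟩

theorem exists_isCompatible (i : Fin k) :
    ∃ D : CycleDecomposition (l.projection i), l.IsCompatible D := by
  classical
  obtain ⟨N, c, hc, hcov⟩ := MultiCycle.exists_decomposition (H := l.projection i)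
    (tail := fun t => l.w t i) (head := fun t => l.w (t + 1) i)
    (Finset.univ.filter fun t => l.IsEdgeOf i t)
    (fun t ht => ⟨(Finset.mem_filter.1 ht).2, rfl⟩) (fun t ht => (Finset.mem_filter.1 ht).2)
    (fun v => by
      have h1 : (Finset.univ.filter fun t => l.w t i = v).card =
          (Finset.univ.filter fun t => l.w (t + 1) i = v).card :=
        (Finset.card_bij (fun r _ => r + 1) (by simp) (fun _ _ _ _ h => add_right_cancel h)
          fun r hr => ⟨r - 1, by simpa using hr, by simp⟩).symm
      have h2 (p : ZMod (2 * l.s) → Prop) [DecidablePred p] :=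
        Finset.card_filter_add_card_filter_not (s := Finset.univ.filter p)
          (p := fun t => l.IsEdgeOf i t)
      have h3 := h2 fun t => l.w t i = v
      have h4 := h2 fun t => l.w (t + 1) i = v
      have h5 : ((Finset.univ.filter fun t => l.w t i = v).filter fun t => ¬ l.IsEdgeOf i t) =
          (Finset.univ.filter fun t => l.w (t + 1) i = v).filter fun t => ¬ l.IsEdgeOf i t := by
        ext t
        simp only [Finset.mem_filter, Finset.mem_univ, true_and, IsEdgeOf, not_not]
        exact ⟨fun h => ⟨h.2 ▸ h.1, h.2⟩, fun h => ⟨h.2.trans h.1, h.2⟩⟩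
      rw [Finset.filter_comm, Finset.filter_comm (p := fun t => l.IsEdgeOf i t)]
      rw [h5] at h3
      omega)
  refine ⟨⟨N, c, fun t ht => hcov t ?_⟩, fun j r => (hc j r).2⟩
  simpa using l.mem_edgeSet_projection.1 ht

variable {l}

theorem even_len {i : Fin k} (hG : (G i).graph.IsBipartite) (c : MultiCycle (l.projection i)) :
    Even c.len := by
  obtain ⟨ε, hε0, hε⟩ := (G i).exists_alternating hG
  exact PlaneGraph.even_len_of_alternating c hε0 fun t => hε _ _ (l.adj_of_isLink (c.isLink t))

theorem sgn_decomposition_eq {i : Fin k} (hG : (G i).graph.IsBipartite)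
    (D : CycleDecomposition (l.projection i)) :
    (G i).sgn D = ∏ j, (-1) ^ ((G i).chi (D.cycle j) + 1) := by
  refine Finset.prod_congr rfl fun j _ => if_neg fun h => ?_
  exact Nat.not_even_iff_odd.2 h.1 (even_len hG _)

theorem sgn_decomposition_eq_sgn {i : Fin k} (hG : (G i).graph.IsBipartite)
    (D D' : CycleDecomposition (l.projection i)) : (G i).sgn D = (G i).sgn D' := by
  classical
  obtain ⟨σ, hσ⟩ := (G i).exists_edgeSign hG
  set E : Finset (ZMod (2 * l.s)) := Finset.univ.filter fun t => l.IsEdgeOf i t with hEdef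
  have hE (t) : t ∈ E ↔ t ∈ (l.projection i).edgeSet := by
    rw [l.mem_edgeSet_projection]
    simp [E]
  suffices h : ∀ D : CycleDecomposition (l.projection i), (G i).sgn D =
      (-1) ^ (E.card / 2) * ∏ t ∈ E, σ s(l.w t i, l.w (t + 1) i) by rw [h, h]
  intro D
  have hlen : ∑ j, (D.cycle j).len = E.card := by
    have := D.sum_sum_edge hE fun _ => (1 : ℕ)
    simpa using this
  have hhalf : ∑ j, (D.cycle j).len / 2 = E.card / 2 := by
    rw [← hlen, Finset.sum_congr rfl fun j _ =>
      (Nat.mul_div_cancel' (even_len hG (D.cycle j)).two_dvd).symm, ← Finset.mul_sum,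
      Nat.mul_div_cancel_left _ two_pos]
  rw [sgn_decomposition_eq hG, ← D.prod_prod_edge hE, ← hhalf, ← Finset.prod_pow_eq_pow_sum,
    ← Finset.prod_mul_distrib]
  refine Finset.prod_congr rfl fun j _ => ?_
  rw [hσ _ fun t => l.adj_of_isLink ((D.cycle j).isLink t)]
  congr 1
  refine Finset.prod_congr rfl fun a _ => ?_
  rw [((D.cycle j).isLink a).2]

theorem signOf_eq_signOf (hG : ∀ i, (G i).graph.IsBipartite)
    (D D' : ∀ i, CycleDecomposition (l.projection i)) : l.signOf D = l.signOf D' := by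
  rw [signOf, signOf, Finset.prod_congr rfl fun i _ => sgn_decomposition_eq_sgn (hG i) (D i) (D' i)]

theorem isSign_signOf (hG : ∀ i, (G i).graph.IsBipartite)
    (D : ∀ i, CycleDecomposition (l.projection i)) : l.IsSign (l.signOf D) := by
  choose D' hD' using l.exists_isCompatible
  exact ⟨D', hD', signOf_eq_signOf hG D D'⟩

theorem eq_signOf_of_isSign (hG : ∀ i, (G i).graph.IsBipartite)
    (D : ∀ i, CycleDecomposition (l.projection i)) {s : ℤ} (hs : l.IsSign s) :
    s = l.signOf D := by
  obtain ⟨D', -, rfl⟩ := hs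
  exact signOf_eq_signOf hG D' D

theorem isSign_sgn : l.IsSign l.sgn := by
  choose D hD using l.exists_isCompatible
  have h : ∃ s, l.IsSign s := ⟨_, D, hD, rfl⟩
  rw [sgn, dif_pos h]
  exact h.choose_spec

end EvenLoop

end
theorem mainTheorem4 {k : ℕ} {n : Fin k → ℕ} (G : ∀ i, PlaneGraph (n i))
    (hG : ∀ i, (G i).graph.IsBipartite) :
    -- the sign of a cycle decomposition does not involve the directions of its cycles
    (∀ (l : EvenLoop G) (i : Fin k) (D : CycleDecomposition (l.projection i)),
      (G i).sgn D = ∏ j, (-1) ^ ((G i).chi (D.cycle j) + 1)) ∧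
    -- the sign of a loop is well defined, and arbitrary cycle decompositions compute it
    (∀ l : EvenLoop G, (∃! s : ℤ, l.IsSign s) ∧ l.IsSign l.sgn ∧
      ∀ D : ∀ i, CycleDecomposition (l.projection i), l.sgn = l.signOf D) ∧
    -- hence arbitrary cycle decompositions compute the weights in the monopole-dimer model
    (∀ (R : Type*) [CommRing R] (x : ProdVertex n → R) (a : Sym2 (ProdVertex n) → R)
      (C : MonopoleDimerConfig G)
      (D : ∀ p i, CycleDecomposition ((C.loop p).projection i)),
      C.weight x a =
        (∏ p, (((C.loop p).signOf (D p) : ℤ) : R) * (C.loop p).edgeWeight a) *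
          ∏ v ∈ C.isolated, x v) := by
  have hsgn (l : EvenLoop G) (D : ∀ i, CycleDecomposition (l.projection i)) :
      l.sgn = l.signOf D := EvenLoop.eq_signOf_of_isSign hG D EvenLoop.isSign_sgn
  refine ⟨fun l i D => EvenLoop.sgn_decomposition_eq (hG i) D, fun l => ⟨?_, ?_, hsgn l⟩, ?_⟩
  · choose D _ using l.exists_isCompatible
    exact ⟨l.signOf D, EvenLoop.isSign_signOf hG D,
      fun s hs => EvenLoop.eq_signOf_of_isSign hG D hs⟩
  · exact EvenLoop.isSign_sgn
  · intro R _ x a C D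
    simp only [MonopoleDimerConfig.weight, EvenLoop.weight, hsgn _ (D _)]
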